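/- Let $(M,g)$ be a non-empty closed smooth Riemannian manifold, let $\alpha$ be a smooth one-form on $M$, and let $X$ be the vector field dual to $\alpha$, $g(X,\cdot)=\alpha$. Assume that $X$ is a Killing vector field, $\mathcal L_Xg=0$. Consider the magnetic Lagrangian $L\colon TM\to\mathbb R$, $L(q,v)=\tfrac12|v|_q^2-\alpha_q(v)$, its Legendre dual $H(q,p)=\tfrac12|p+\alpha_q|_q^2$ on $T^*M$, and the Euler–Lagrange flow $\Phi_L$ on $TM$. Put $$\|\alpha\|_\infty=\max_{q\in M}|\alpha_q|,\qquad M_\alpha=\{q\in M:\tfrac12|\alpha_q|^2=\tfrac12\|\alpha\|_\infty^2\}.$$ For a $\Phi_L$-invariant Borel probability measure $\mu$ on $TM$ let $S_L(\mu)=\int_{TM}L\,d\mu\in(-\infty,+\infty]$ be its action. The Mather set $\widetilde{\mathcal M}\subset TM$ is the union of the supports of all $\Phi_L$-invariant Borel probability measures which minimize $S_L$ among such measures, and $\mathcal M\subset M$ is its projection to $M$. Then the following hold. 1. The Mañé critical value is $c(L)=\tfrac12\|\alpha\|_\infty^2$, in each of its three usual descriptions: $$\inf_{f\in C^\infty(M)}\sup_{q\in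 M}H(q,d_qf)=\inf\Big\{k\in\mathbb R:\int_0^T\big(L(\gamma,\dot\gamma)+k\big)dt\ge 0\ \text{ for all } T>0 \text{ and all loops } \gamma\Big\}=-\inf_\mu S_L(\mu)=\tfrac12\|\alpha\|_\infty^2 .$$ Here the loops are the piecewise $C^1$ curves $\gamma\colon[0,T]\to M$ with $\gamma(0)=\gamma(T)$, and $\mu$ runs over the $\Phi_L$-invariant Borel probability measures on $TM$. 2. The flow of $X$ maps $M_\alpha$ onto itself, and the projected Mather set $\mathcal M$ is the union of the supports of all Borel probability measures on $M_\alpha$ that are invariant under the flow of $X|_{M_\alpha}$. In particular, $\mathcal M$ contains all periodic orbits of $X|_{M_\alpha}$. 3. The Mather set is $\widetilde{\mathcal M}=X(\mathcal M)$. -/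

import Mathlib

open Bundle Manifold MeasureTheory Set
open scoped Manifold ContDiff Topology

noncomputable section

namespace MagneticMane

/-- The model space `ℝⁿ`. -/
abbrev Model (n : ℕ) : Type := EuclideanSpace ℝ (Fin n)

/-- A smooth Riemannian metric on an `n`-manifold `M`. -/
abbrev Metric (n : ℕ) (M : Type*) [TopologicalSpace M] [ChartedSpace (Model n) M]
    [IsManifold (𝓡 n) ∞ M] : Type _ :=
  ContMDiffRiemannianMetric (𝓡 n) ∞ (Model n) (fun q : M => TangentSpace (𝓡 n) q)

variable {n : ℕ} {M : Type*} [TopologicalSpace M] [ChartedSpace (Model n) M]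
  [IsManifold (𝓡 n) ∞ M]

/-! ### Riemannian geometry -/

/-- Every covector is represented by a tangent vector through the metric. -/
theorem exists_dual (g : Metric n M) (q : M) (p : TangentSpace (𝓡 n) q →L[ℝ] ℝ) :
    ∃ w : TangentSpace (𝓡 n) q, ∀ v, g.inner q w v = p v := by
  have : FiniteDimensional ℝ (TangentSpace (𝓡 n) q) :=
    inferInstanceAs (FiniteDimensional ℝ (Model n))
  let F : TangentSpace (𝓡 n) q →ₗ[ℝ] Module.Dual ℝ (TangentSpace (𝓡 n) q) :=
    { toFun := fun w => (g.inner q w).toLinearMap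
      map_add' := fun a b => by ext v; simp
      map_smul' := fun a b => by ext v; simp }
  have hF : Function.Injective F := by
    rw [injective_iff_map_eq_zero]
    intro w hw
    by_contra h
    have h1 := g.pos q w h
    have h2 : F w w = 0 := by rw [hw]; rfl
    exact absurd h2 (ne_of_gt h1)
  have hs : Function.Surjective F :=
    (LinearMap.injective_iff_surjective_of_finrank_eq_finrank
      (Subspace.dual_finrank_eq (K := ℝ)).symm).1 hF
  obtain ⟨w, hw⟩ := hs p.toLinearMap
  exact ⟨w, fun v => LinearMap.congr_fun hw v⟩

/-- The tangent vector `p♯` metrically dual to the covector `p`: `g(p♯, v) = p(v)` for all `v`. -/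
def sharp (g : Metric n M) (q : M) (p : TangentSpace (𝓡 n) q →L[ℝ] ℝ) : TangentSpace (𝓡 n) q :=
  (exists_dual g q p).choose

theorem sharp_spec (g : Metric n M) (q : M) (p : TangentSpace (𝓡 n) q →L[ℝ] ℝ)
    (v : TangentSpace (𝓡 n) q) : g.inner q (sharp g q p) v = p v :=
  (exists_dual g q p).choose_spec v

/-- The norm `|p|_q` of a covector with respect to the metric dual to `g`. -/
def conorm (g : Metric n M) (q : M) (p : TangentSpace (𝓡 n) q →L[ℝ] ℝ) : ℝ :=
  Real.sqrt (g.inner q (sharp g q p) (sharp g q p))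

/-- The vector field `X` metrically dual to the one-form `α`. -/
def dualField (g : Metric n M) (α : (q : M) → TangentSpace (𝓡 n) q →L[ℝ] ℝ) (q : M) :
    TangentSpace (𝓡 n) q :=
  sharp g q (α q)

/-- A vector field seen as a map `M → TM`. -/
def toTangent (X : (q : M) → TangentSpace (𝓡 n) q) (q : M) : TangentBundle (𝓡 n) M :=
  ⟨q, X q⟩

/-- `X` is a Killing vector field: a smooth vector field with `𝓛_X g = 0`, that is,
`X(g(Y, Z)) = g([X, Y], Z) + g(Y, [X, Z])` for all smooth vector fields `Y`, `Z`. -/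
structure IsKilling (g : Metric n M) (X : (q : M) → TangentSpace (𝓡 n) q) : Prop where
  smooth : ContMDiff (𝓡 n) (𝓡 n).tangent ∞ (toTangent X)
  lieDeriv_eq_zero : ∀ Y Z : (q : M) → TangentSpace (𝓡 n) q,
    ContMDiff (𝓡 n) (𝓡 n).tangent ∞ (toTangent Y) →
    ContMDiff (𝓡 n) (𝓡 n).tangent ∞ (toTangent Z) → ∀ q : M,
    mfderiv (𝓡 n) 𝓘(ℝ, ℝ) (fun x => g.inner x (Y x) (Z x)) q (X q)
      = g.inner q (VectorField.mlieBracket (𝓡 n) X Y q) (Z q)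
        + g.inner q (Y q) (VectorField.mlieBracket (𝓡 n) X Z q)

/-- The supremum norm `‖α‖_∞ = max_q |α_q|` of a one-form (`M` is compact and non-empty). -/
def supNorm (g : Metric n M) (α : (q : M) → TangentSpace (𝓡 n) q →L[ℝ] ℝ) : ℝ :=
  ⨆ q : M, conorm g q (α q)

/-- The set `M_α` of maximizers of `½|α|²`. -/
def maxSet (g : Metric n M) (α : (q : M) → TangentSpace (𝓡 n) q →L[ℝ] ℝ) : Set M :=
  {q | 1 / 2 * conorm g q (α q) ^ 2 = 1 / 2 * supNorm g α ^ 2}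

/-! ### Lagrangian dynamics -/

/-- The magnetic Lagrangian `L(q, v) = ½|v|² - α_q(v)`. -/
def magneticLagrangian (g : Metric n M) (α : (q : M) → TangentSpace (𝓡 n) q →L[ℝ] ℝ)
    (z : TangentBundle (𝓡 n) M) : ℝ :=
  1 / 2 * g.inner z.1 z.2 z.2 - α z.1 z.2

/-- The magnetic Hamiltonian `H(q, p) = ½|p + α_q|²`. -/
def magneticHamiltonian (g : Metric n M) (α : (q : M) → TangentSpace (𝓡 n) q →L[ℝ] ℝ)
    (q : M) (p : TangentSpace (𝓡 n) q →L[ℝ] ℝ) : ℝ :=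
  1 / 2 * conorm g q (p + α q) ^ 2

/-- The lift `t ↦ (γ(t), γ'(t))` of a curve to the tangent bundle. -/
def lift (γ : ℝ → M) (t : ℝ) : TangentBundle (𝓡 n) M :=
  ⟨γ t, mfderiv 𝓘(ℝ, ℝ) (𝓡 n) γ t (1 : ℝ)⟩

/-- The expression of `L` in the coordinates `(y, w)` of the tangent bundle induced by the
chart at `x₀`. -/
def localLagrangian (L : TangentBundle (𝓡 n) M → ℝ) (x₀ : M) (y w : Model n) : ℝ :=
  L ⟨(extChartAt (𝓡 n) x₀).symm y,
    mfderiv 𝓘(ℝ, Model n) (𝓡 n) (extChartAt (𝓡 n) x₀).symm y w⟩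

/-- `γ : ℝ → M` is a `C²` solution of the Euler--Lagrange equation
`d/dt (∂L/∂v) = ∂L/∂q` in every chart. -/
def IsEulerLagrange (L : TangentBundle (𝓡 n) M → ℝ) (γ : ℝ → M) : Prop :=
  ContMDiff 𝓘(ℝ, ℝ) (𝓡 n) 2 γ ∧
  ∀ (x₀ : M) (t : ℝ), γ t ∈ (extChartAt (𝓡 n) x₀).source → ∀ u : Model n,
    HasDerivAt
      (fun s : ℝ => fderiv ℝ (localLagrangian L x₀ (extChartAt (𝓡 n) x₀ (γ s)))
        (deriv (fun r : ℝ => extChartAt (𝓡 n) x₀ (γ r)) s) u)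
      (fderiv ℝ (fun y => localLagrangian L x₀ y
        (deriv (fun r : ℝ => extChartAt (𝓡 n) x₀ (γ r)) t)) (extChartAt (𝓡 n) x₀ (γ t)) u)
      t

open Classical in
/-- The Euler--Lagrange flow `Φ_L^t` on `TM`: follow the solution with the given initial
position and velocity (by convention, stay put if no solution is defined for all times; for
magnetic Lagrangians on closed manifolds this does not occur). -/
def eulerLagrangeFlow (L : TangentBundle (𝓡 n) M → ℝ) (t : ℝ) (z : TangentBundle (𝓡 n) M) :
    TangentBundle (𝓡 n) M :=
  if h : ∃ γ : ℝ → M, IsEulerLagrange L γ ∧ lift γ 0 = z then lift h.choose t else z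

open Classical in
/-- The flow of a vector field `X` on `M` (by convention, stay put if no integral curve is
defined for all times; for smooth `X` on a closed manifold this does not occur). -/
def flow (X : (q : M) → TangentSpace (𝓡 n) q) (t : ℝ) (q : M) : M :=
  if h : ∃ γ : ℝ → M, IsMIntegralCurve (I := 𝓡 n) γ X ∧ γ 0 = q then h.choose t else q

/-- `μ` is a Borel probability measure invariant under the one-parameter family `φ`. -/
def IsInvariantProb {Z : Type*} [MeasurableSpace Z] (φ : ℝ → Z → Z) (μ : Measure Z) : Prop :=
  IsProbabilityMeasure μ ∧ ∀ t : ℝ, μ.map (φ t) = μ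

open Classical in
/-- The action `S_L(μ) = ∫ L dμ`, with value `+∞` when `L` is not `μ`-integrable (our Lagrangians
are continuous and bounded below, so then the integral is `+∞`). -/
def action [MeasurableSpace (TangentBundle (𝓡 n) M)] (L : TangentBundle (𝓡 n) M → ℝ)
    (μ : Measure (TangentBundle (𝓡 n) M)) : EReal :=
  if Integrable L μ then ((∫ z, L z ∂μ : ℝ) : EReal) else ⊤

/-- `μ` has minimal action among the probability measures invariant under `Φ_L`. -/
def IsActionMinimizing [MeasurableSpace (TangentBundle (𝓡 n) M)]
    (L : TangentBundle (𝓡 n) M → ℝ) (μ : Measure (TangentBundle (𝓡 n) M)) : Prop :=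
  IsInvariantProb (eulerLagrangeFlow L) μ ∧
  ∀ ν : Measure (TangentBundle (𝓡 n) M), IsInvariantProb (eulerLagrangeFlow L) ν →
    action L μ ≤ action L ν

/-- The Mather set: the union of the supports of the action-minimizing measures. -/
def matherSet [MeasurableSpace (TangentBundle (𝓡 n) M)] (L : TangentBundle (𝓡 n) M → ℝ) :
    Set (TangentBundle (𝓡 n) M) :=
  ⋃ (μ : Measure (TangentBundle (𝓡 n) M)) (_ : IsActionMinimizing L μ), μ.support

/-- The projected Mather set. -/
def projectedMatherSet [MeasurableSpace (TangentBundle (𝓡 n) M)]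
    (L : TangentBundle (𝓡 n) M → ℝ) : Set M :=
  TotalSpace.proj '' matherSet L

/-! ### The three descriptions of the Mañé critical value -/

/-- `inf_{f ∈ C^∞(M)} sup_q H(q, d_q f)`. -/
def maneValueHamiltonian (H : (q : M) → (TangentSpace (𝓡 n) q →L[ℝ] ℝ) → ℝ) : EReal :=
  ⨅ f : C^∞⟮𝓡 n, M; 𝓘(ℝ, ℝ), ℝ⟯, ⨆ q : M,
    ((H q (mfderiv (𝓡 n) 𝓘(ℝ, ℝ) f q : TangentSpace (𝓡 n) q →L[ℝ] ℝ) : ℝ) : EReal)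

/-- `γ` restricted to `[0, T]` is continuous and piecewise `C¹`: it is `C¹` on every closed
subinterval whose interior avoids a suitable finite set of break points. -/
def IsPiecewiseC1 (T : ℝ) (γ : ℝ → M) : Prop :=
  ContinuousOn γ (Icc 0 T) ∧
  ∃ s : Finset ℝ, ∀ a b : ℝ, 0 ≤ a → a < b → b ≤ T → (∀ c ∈ s, c ∉ Ioo a b) →
    ContMDiffOn 𝓘(ℝ, ℝ) (𝓡 n) 1 γ (Icc a b)

/-- The infimum of the `k` for which `S_{L+k}(γ) = ∫₀ᵀ (L(γ, γ') + k) dt ≥ 0` for all loops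
`γ : [0, T] → M`, `T > 0`. -/
def maneValueLoops (L : TangentBundle (𝓡 n) M → ℝ) : EReal :=
  sInf ((fun k : ℝ => (k : EReal)) '' {k : ℝ | ∀ T : ℝ, 0 < T → ∀ γ : ℝ → M,
    IsPiecewiseC1 (n := n) T γ → γ 0 = γ T → 0 ≤ ∫ t in (0 : ℝ)..T, (L (lift γ t) + k)})

/-- Minus the infimum of the actions of the probability measures invariant under `Φ_L`. -/
def maneValueMeasures [MeasurableSpace (TangentBundle (𝓡 n) M)]
    (L : TangentBundle (𝓡 n) M → ℝ) : EReal :=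
  -⨅ (μ : Measure (TangentBundle (𝓡 n) M)) (_ : IsInvariantProb (eulerLagrangeFlow L) μ),
    action L μ

end MagneticMane

end

noncomputable section

namespace MagneticMane

variable {n : ℕ} {M : Type*} [TopologicalSpace M] [ChartedSpace (Model n) M]
  [IsManifold (𝓡 n) ∞ M]

section

/-! ### Algebra of the magnetic Lagrangian in a fiber -/

/-! Write `c = ½‖α‖_∞²`. Completing the square with the dual field gives `L(q, v) = ½|v - X|² -
½|α|²`. Hence `L ≥ -c` pointwise, with equality exactly on `X(M_α)`
(`magneticLagrangian_eq_neg_iff`). Everything rests on this set of pointwise minima being invariant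
under the dynamics.

The Killing identity for the pair `X, X` reads `X(|X|²) = 0`, so the flow of `X` preserves `M_α`.
The lift of an orbit in `M_α` runs through global minima of `L`, where both partial derivatives
vanish in every chart, and the Euler–Lagrange equation becomes `0 = 0`
(`isEulerLagrange_of_mem_maxSet`). Uniqueness for that equation, obtained through the Legendre
transform, shows that every Euler–Lagrange curve issuing from `X(M_α)` is such an orbit. So `X`
conjugates the flow on `M_α` to `Φ_L` on `X(M_α)`.

Krylov–Bogolyubov provides an invariant measure on `M_α`; its pushforward by `X` has action `-c`,
the least possible for any probability measure. Conversely, action `-c` forces `L = -c` almost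
everywhere. The minimizing measures are therefore exactly these pushforwards
(`isActionMinimizing_iff`), and `X` carries supports to supports.

For the Hamiltonian value, `f = 0` gives at most `c`; if `H(df) ≤ b < c`, then `f` falls at a
definite rate along an orbit in `M_α`, which compactness forbids. For loops, `L + c ≥ 0` gives one
bound; if `k < c`, a long piece of an orbit in `M_α` between two visits near a cluster point, closed
by a segment of bounded cost, is a loop of negative action. -/

theorem inner_self_nonneg (g : Metric n M) (q : M) (v : TangentSpace (𝓡 n) q) :
    0 ≤ g.inner q v v := by
  by_cases h : v = 0
  · simp [h]
  · exact (g.pos q v h).le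

theorem conorm_sq (g : Metric n M) (q : M) (p : TangentSpace (𝓡 n) q →L[ℝ] ℝ) :
    conorm g q p ^ 2 = g.inner q (sharp g q p) (sharp g q p) :=
  Real.sq_sqrt (inner_self_nonneg g q _)

theorem conorm_nonneg (g : Metric n M) (q : M) (p : TangentSpace (𝓡 n) q →L[ℝ] ℝ) :
    0 ≤ conorm g q p := Real.sqrt_nonneg _

theorem inner_sub_self (g : Metric n M) (q : M) (v w : TangentSpace (𝓡 n) q) :
    g.inner q (v - w) (v - w) = g.inner q v v - 2 * g.inner q w v + g.inner q w w := by
  have := g.symm q v w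
  simp only [map_sub, _root_.sub_apply]
  linarith

/-- Completing the square in the magnetic Lagrangian. -/
theorem magneticLagrangian_eq (g : Metric n M) (α : (q : M) → TangentSpace (𝓡 n) q →L[ℝ] ℝ)
    (z : TangentBundle (𝓡 n) M) :
    magneticLagrangian g α z = 1 / 2 * g.inner z.1 (z.2 - dualField g α z.1)
      (z.2 - dualField g α z.1) - 1 / 2 * conorm g z.1 (α z.1) ^ 2 := by
  have h1 : α z.1 z.2 = g.inner z.1 (dualField g α z.1) z.2 := (sharp_spec g z.1 (α z.1) z.2).symm
  have h2 : conorm g z.1 (α z.1) ^ 2 = g.inner z.1 (dualField g α z.1) (dualField g α z.1) :=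
    conorm_sq g z.1 (α z.1)
  rw [magneticLagrangian, inner_sub_self, h1, h2]
  ring

/-- Young's inequality for a covector and a vector. -/
theorem apply_le_conorm (g : Metric n M) (q : M) (p : TangentSpace (𝓡 n) q →L[ℝ] ℝ)
    (v : TangentSpace (𝓡 n) q) : p v ≤ 1 / 2 * conorm g q p ^ 2 + 1 / 2 * g.inner q v v := by
  have h := inner_self_nonneg g q (v - sharp g q p)
  rw [inner_sub_self, sharp_spec, ← conorm_sq] at h
  linarith

/-! ### Smoothness of metric expressions -/

/-- The base map `b` is arbitrary so that the result serves fields on `M`, the fiber variable on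
`TM`, and coordinate vectors over a chart. -/
theorem contMDiffAt_inner {EN HN N : Type*} [NormedAddCommGroup EN] [NormedSpace ℝ EN]
    [TopologicalSpace HN] {IN : ModelWithCorners ℝ EN HN} [TopologicalSpace N] [ChartedSpace HN N]
    (g : Metric n M) {b : N → M} {v w : (x : N) → TangentSpace (𝓡 n) (b x)} {x : N}
    (hv : ContMDiffAt IN (𝓡 n).tangent ∞ (fun x => (⟨b x, v x⟩ : TangentBundle (𝓡 n) M)) x)
    (hw : ContMDiffAt IN (𝓡 n).tangent ∞ (fun x => (⟨b x, w x⟩ : TangentBundle (𝓡 n) M)) x) :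
    ContMDiffAt IN 𝓘(ℝ, ℝ) ∞ (fun x => g.inner (b x) (v x) (w x)) x := by
  have hb : ContMDiffAt IN (𝓡 n) ∞ b x := by
    simp only [contMDiffAt_totalSpace] at hv
    exact hv.1
  have : ContMDiffAt IN ((𝓡 n).prod 𝓘(ℝ)) ∞
      (fun m ↦ TotalSpace.mk' ℝ (E := Bundle.Trivial M ℝ) (b m) (g.inner (b m) (v m) (w m))) x := by
    apply ContMDiffAt.clm_bundle_apply₂ (F₁ := Model n) (F₂ := Model n)
    · exact ContMDiffAt.comp x g.contMDiff.contMDiffAt hb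
    · exact hv
    · exact hw
  simp only [contMDiffAt_totalSpace] at this
  exact this.2

/-- Since `α v = g(X, v)`, both terms are metric pairings of smooth sections over the projection of
`TM`. -/
theorem contMDiff_magneticLagrangian (g : Metric n M)
    (α : (q : M) → TangentSpace (𝓡 n) q →L[ℝ] ℝ)
    (hX : ContMDiff (𝓡 n) (𝓡 n).tangent ∞ (toTangent (dualField g α))) :
    ContMDiff (𝓡 n).tangent 𝓘(ℝ, ℝ) ∞ (magneticLagrangian g α) := by
  intro z
  have h1 : ContMDiffAt (𝓡 n).tangent (𝓡 n).tangent ∞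
      (fun z : TangentBundle (𝓡 n) M => (⟨z.1, z.2⟩ : TangentBundle (𝓡 n) M)) z := contMDiffAt_id
  have h2 : ContMDiffAt (𝓡 n).tangent (𝓡 n).tangent ∞
      (fun z : TangentBundle (𝓡 n) M => (⟨z.1, dualField g α z.1⟩ : TangentBundle (𝓡 n) M)) z :=
    hX.contMDiffAt.comp z (contMDiffAt_proj _)
  have h3 := contMDiffAt_const (I := (𝓡 n).tangent) (I' := 𝓘(ℝ, ℝ)) (c := (1 / 2 : ℝ)) (n := ∞) (x := z)
  have h4 := contMDiffAt_inner g h1 h1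
  have h5 := contMDiffAt_inner g h2 h1
  refine ((h3.mul h4).sub h5).congr_of_eventuallyEq (Filter.Eventually.of_forall fun y => ?_)
  simp only [magneticLagrangian, Pi.mul_apply]
  rw [show α y.1 y.2 = g.inner y.1 (dualField g α y.1) y.2 from (sharp_spec g y.1 (α y.1) y.2).symm]

/-! ### Coordinates on the tangent bundle -/

/-- The tangent vector with coordinates `w` at the point with coordinates `y`. -/
def ofCoord (x₀ : M) (y w : Model n) : TangentBundle (𝓡 n) M :=
  ⟨(extChartAt (𝓡 n) x₀).symm y, mfderiv 𝓘(ℝ, Model n) (𝓡 n) (extChartAt (𝓡 n) x₀).symm y w⟩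

/-- The expression of a vector field in the chart at `x₀`. -/
def coordField (X : (q : M) → TangentSpace (𝓡 n) q) (x₀ : M) (y : Model n) : Model n :=
  mfderiv (𝓡 n) 𝓘(ℝ, Model n) (extChartAt (𝓡 n) x₀) ((extChartAt (𝓡 n) x₀).symm y)
    (X ((extChartAt (𝓡 n) x₀).symm y))

theorem mfderiv_symm_mfderiv {x₀ : M} {y : Model n} (hy : y ∈ (extChartAt (𝓡 n) x₀).target)
    (v : TangentSpace (𝓡 n) ((extChartAt (𝓡 n) x₀).symm y)) :
    mfderiv 𝓘(ℝ, Model n) (𝓡 n) (extChartAt (𝓡 n) x₀).symm y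
      (mfderiv (𝓡 n) 𝓘(ℝ, Model n) (extChartAt (𝓡 n) x₀) ((extChartAt (𝓡 n) x₀).symm y) v) = v := by
  have := mfderivWithin_extChartAt_symm_comp_mfderiv_extChartAt hy
  rw [ModelWithCorners.range_eq_univ, mfderivWithin_univ] at this
  exact DFunLike.congr_fun this v

theorem mfderiv_mfderiv_symm {x₀ : M} {y : Model n} (hy : y ∈ (extChartAt (𝓡 n) x₀).target)
    (w : Model n) :
    mfderiv (𝓡 n) 𝓘(ℝ, Model n) (extChartAt (𝓡 n) x₀) ((extChartAt (𝓡 n) x₀).symm y)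
      (mfderiv 𝓘(ℝ, Model n) (𝓡 n) (extChartAt (𝓡 n) x₀).symm y w) = w := by
  have := mfderiv_extChartAt_comp_mfderivWithin_extChartAt_symm hy
  rw [ModelWithCorners.range_eq_univ, mfderivWithin_univ] at this
  exact DFunLike.congr_fun this w

theorem ofCoord_coordField (X : (q : M) → TangentSpace (𝓡 n) q) {x₀ : M} {y : Model n}
    (hy : y ∈ (extChartAt (𝓡 n) x₀).target) :
    ofCoord x₀ y (coordField X x₀ y) = toTangent X ((extChartAt (𝓡 n) x₀).symm y) := by
  simp only [ofCoord, coordField, toTangent, mfderiv_symm_mfderiv hy]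

theorem contMDiff_prodMk_tangent : ContMDiff 𝓘(ℝ, Model n × Model n) 𝓘(ℝ, Model n).tangent ∞
    (fun p : Model n × Model n => (⟨p.1, p.2⟩ : TangentBundle 𝓘(ℝ, Model n) (Model n))) := by
  intro p
  rw [contMDiffAt_totalSpace]
  refine ⟨contDiff_fst.contMDiff.contMDiffAt, ?_⟩
  simp only [trivializationAt_model_space_apply]
  exact contDiff_snd.contMDiff.contMDiffAt

/-- `ofCoord` is the tangent map of the inverse chart, hence smooth on the whole bundle over the
target. -/
theorem contMDiffOn_ofCoord (x₀ : M) :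
    ContMDiffOn 𝓘(ℝ, Model n × Model n) (𝓡 n).tangent ∞
      (fun p : Model n × Model n => ofCoord x₀ p.1 p.2) ((extChartAt (𝓡 n) x₀).target ×ˢ univ) := by
  have h := (contMDiffOn_extChartAt_symm (I := 𝓡 n) (n := ∞) x₀).contMDiffOn_tangentMapWithin
    (m := ∞) le_rfl (isOpen_extChartAt_target x₀).uniqueMDiffOn
  refine (h.comp contMDiff_prodMk_tangent.contMDiffOn (fun p hp => hp.1)).congr fun p hp => ?_
  simp only [Function.comp, tangentMapWithin, ofCoord]
  rw [mfderivWithin_of_isOpen (isOpen_extChartAt_target x₀) hp.1]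

theorem contDiffOn_coordField {X : (q : M) → TangentSpace (𝓡 n) q}
    (hX : ContMDiff (𝓡 n) (𝓡 n).tangent ∞ (toTangent X)) (x₀ : M) :
    ContDiffOn ℝ ∞ (coordField X x₀) (extChartAt (𝓡 n) x₀).target := by
  have h := (contMDiffOn_extChartAt (I := 𝓡 n) (n := ∞) (x := x₀)).contMDiffOn_tangentMapWithin
    (m := ∞) le_rfl (chartAt (Model n) x₀).open_source.uniqueMDiffOn
  have h2 := h.comp (hX.comp_contMDiffOn (contMDiffOn_extChartAt_symm (I := 𝓡 n) (n := ∞) x₀)) (fun y hy => by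
      have := (extChartAt (𝓡 n) x₀).map_target hy
      rwa [extChartAt_source] at this)
  intro y hy
  have h3 := h2 y hy
  rw [contMDiffWithinAt_totalSpace] at h3
  simp only [trivializationAt_model_space_apply] at h3
  refine (contMDiffWithinAt_iff_contDiffWithinAt.1 h3.2).congr_of_mem (fun y hy => ?_) hy
  have := (extChartAt (𝓡 n) x₀).map_target hy
  rw [extChartAt_source] at this
  simp only [Function.comp, tangentMapWithin, toTangent, coordField]
  rw [mfderivWithin_of_isOpen (chartAt (Model n) x₀).open_source this]

/-- Turns coordinate solutions into curves on `M`, with the velocity in the `smulRight` form used by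
`IsMIntegralCurve`. -/
theorem hasMFDerivAt_ofCoord {x₀ : M} {y : ℝ → Model n} {w : Model n} {t : ℝ}
    (hy : HasDerivAt y w t) (ht : y t ∈ (extChartAt (𝓡 n) x₀).target) :
    HasMFDerivAt 𝓘(ℝ, ℝ) (𝓡 n) (fun s => (extChartAt (𝓡 n) x₀).symm (y s)) t
      ((1 : ℝ →L[ℝ] ℝ).smulRight (ofCoord x₀ (y t) w).2) := by
  have h1 : MDifferentiableAt 𝓘(ℝ, Model n) (𝓡 n) (extChartAt (𝓡 n) x₀).symm (y t) :=
    (((contMDiffOn_extChartAt_symm (I := 𝓡 n) (n := ∞) x₀).contMDiffAt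
      ((isOpen_extChartAt_target x₀).mem_nhds ht))).mdifferentiableAt (by simp)
  have h2 := h1.hasMFDerivAt.comp t hy.hasFDerivAt.hasMFDerivAt
  refine h2.congr_mfderiv (ContinuousLinearMap.ext_ring ?_)
  change mfderiv 𝓘(ℝ, Model n) (𝓡 n) (extChartAt (𝓡 n) x₀).symm (y t) ((1 : ℝ) • w)
    = (1 : ℝ) • mfderiv 𝓘(ℝ, Model n) (𝓡 n) (extChartAt (𝓡 n) x₀).symm (y t) w
  exact map_smul _ _ _

theorem hasDerivAt_extChartAt_comp {x₀ : M} {γ : ℝ → M} {t : ℝ}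
    {v : TangentSpace (𝓡 n) (γ t)}
    (h : HasMFDerivAt 𝓘(ℝ, ℝ) (𝓡 n) γ t ((1 : ℝ →L[ℝ] ℝ).smulRight v))
    (ht : γ t ∈ (extChartAt (𝓡 n) x₀).source) :
    HasDerivAt (fun s => extChartAt (𝓡 n) x₀ (γ s))
      (mfderiv (𝓡 n) 𝓘(ℝ, Model n) (extChartAt (𝓡 n) x₀) (γ t) v : Model n) t := by
  have h1 : MDifferentiableAt (𝓡 n) 𝓘(ℝ, Model n) (extChartAt (𝓡 n) x₀) (γ t) :=
    mdifferentiableAt_extChartAt (by rwa [extChartAt_source] at ht)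
  let D : ℝ →L[ℝ] Model n := (mfderiv (𝓡 n) 𝓘(ℝ, Model n) (extChartAt (𝓡 n) x₀) (γ t)).comp
    ((1 : ℝ →L[ℝ] ℝ).smulRight v)
  have h2 : HasFDerivAt (fun s => extChartAt (𝓡 n) x₀ (γ s)) D t :=
    (h1.hasMFDerivAt.comp t h).hasFDerivAt
  have h3 := h2.hasDerivAt
  have h4 : D (1 : ℝ) = mfderiv (𝓡 n) 𝓘(ℝ, Model n) (extChartAt (𝓡 n) x₀) (γ t) v := by
    change mfderiv (𝓡 n) 𝓘(ℝ, Model n) (extChartAt (𝓡 n) x₀) (γ t) ((1 : ℝ) • v) = _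
    rw [one_smul]
  exact h4 ▸ h3

omit [IsManifold (𝓡 n) ∞ M] in
theorem _root_.MDifferentiableAt.hasMFDerivAt_lift {γ : ℝ → M} {t : ℝ}
    (h : MDifferentiableAt 𝓘(ℝ, ℝ) (𝓡 n) γ t) :
    HasMFDerivAt 𝓘(ℝ, ℝ) (𝓡 n) γ t
      ((1 : ℝ →L[ℝ] ℝ).smulRight (mfderiv 𝓘(ℝ, ℝ) (𝓡 n) γ t (1 : ℝ))) := by
  refine h.hasMFDerivAt.congr_mfderiv (ContinuousLinearMap.ext_ring ?_)
  exact (one_smul ℝ (mfderiv 𝓘(ℝ, ℝ) (𝓡 n) γ t (1 : ℝ))).symm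

omit [IsManifold (𝓡 n) ∞ M] in
theorem lift_eq_of_hasMFDerivAt {γ : ℝ → M} {t : ℝ} {v : TangentSpace (𝓡 n) (γ t)}
    (h : HasMFDerivAt 𝓘(ℝ, ℝ) (𝓡 n) γ t ((1 : ℝ →L[ℝ] ℝ).smulRight v)) :
    lift γ t = (⟨γ t, v⟩ : TangentBundle (𝓡 n) M) := by
  simp only [lift, h.mfderiv]
  congr 1
  exact one_smul ℝ v

/-- The lift of a differentiable curve in coordinates. -/
theorem ofCoord_deriv {x₀ : M} {γ : ℝ → M} {t : ℝ}
    (h : MDifferentiableAt 𝓘(ℝ, ℝ) (𝓡 n) γ t) (ht : γ t ∈ (extChartAt (𝓡 n) x₀).source) :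
    ofCoord x₀ (extChartAt (𝓡 n) x₀ (γ t)) (deriv (fun s => extChartAt (𝓡 n) x₀ (γ s)) t)
      = lift γ t := by
  have h1 := hasDerivAt_extChartAt_comp h.hasMFDerivAt_lift ht
  have h2 := hasMFDerivAt_ofCoord h1 ((extChartAt (𝓡 n) x₀).map_source ht)
  have hev : γ =ᶠ[𝓝 t] fun s => (extChartAt (𝓡 n) x₀).symm (extChartAt (𝓡 n) x₀ (γ s)) := by
    filter_upwards [h.continuousAt.preimage_mem_nhds
      ((isOpen_extChartAt_source x₀).mem_nhds ht)] with s hs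
    exact ((extChartAt (𝓡 n) x₀).left_inv hs).symm
  have h3 := lift_eq_of_hasMFDerivAt h2
  rw [h1.deriv]
  have h4 : lift (n := n) γ t
      = lift (fun s => (extChartAt (𝓡 n) x₀).symm (extChartAt (𝓡 n) x₀ (γ s))) t := by
    simp only [lift]
    rw [hev.mfderiv_eq]
    congr 1
    exact hev.eq_of_nhds
  rw [h4, h3]
  rfl

end

section

/-! ### The flow of a smooth vector field on a closed manifold -/

/-- Picard–Lindelöf with continuous dependence on the initial point. The box is then shrunk, by
continuity at `(y₀, 0)`, so that trajectories remain in `T` (later the chart target). -/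
theorem _root_.ContDiffAt.exists_continuousOn_local_flow {E : Type*} [NormedAddCommGroup E]
    [NormedSpace ℝ E] [CompleteSpace E] {ξ : E → E} {y₀ : E} (hξ : ContDiffAt ℝ 1 ξ y₀) {T : Set E}
    (hT : T ∈ 𝓝 y₀) :
    ∃ δ > 0, ∃ β : E × ℝ → E,
      (∀ y ∈ Metric.ball y₀ δ, β (y, 0) = y ∧ ∀ t ∈ Ioo (-δ) δ,
        HasDerivAt (fun s => β (y, s)) (ξ (β (y, t))) t ∧ β (y, t) ∈ T) ∧
      ContinuousOn β (Metric.ball y₀ δ ×ˢ Ioo (-δ) δ) := by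
  obtain ⟨ε, hε, a, r, L, K, hr, hpl⟩ := IsPicardLindelof.of_contDiffAt_one hξ
  obtain ⟨β, hβ, hβc⟩ := (hpl 0).exists_forall_mem_closedBall_eq_hasDerivWithinAt_continuousOn
  simp only [zero_sub, zero_add] at hβ hβc
  have hβ0 : β (y₀, 0) = y₀ := (hβ _ (Metric.mem_closedBall_self r.2)).1
  have hD : Metric.closedBall y₀ r ×ˢ Icc (-ε) ε ∈ 𝓝 (y₀, (0 : ℝ)) :=
    prod_mem_nhds (Metric.closedBall_mem_nhds _ hr) (Icc_mem_nhds (by linarith) hε)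
  have hN : β ⁻¹' T ∈ 𝓝 (y₀, (0 : ℝ)) :=
    (hβc.continuousAt hD).preimage_mem_nhds (by rwa [hβ0])
  obtain ⟨ρ, hρ, hball⟩ := Metric.mem_nhds_iff.1 (Filter.inter_mem hD hN)
  have hmem : ∀ y ∈ Metric.ball y₀ (min ρ ε), ∀ t ∈ Ioo (-min ρ ε) (min ρ ε),
      (y, t) ∈ (Metric.closedBall y₀ r ×ˢ Icc (-ε) ε) ∩ β ⁻¹' T := by
    intro y hy t ht
    refine hball ?_
    rw [← ball_prod_same, mem_prod]
    refine ⟨Metric.ball_subset_ball (min_le_left _ _) hy, ?_⟩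
    rw [Real.ball_eq_Ioo, zero_sub, zero_add]
    exact ⟨by linarith [ht.1, min_le_left ρ ε], ht.2.trans_le (min_le_left _ _)⟩
  have h0 : (0 : ℝ) ∈ Ioo (-min ρ ε) (min ρ ε) := by
    have := lt_min hρ hε
    exact ⟨by linarith, this⟩
  refine ⟨min ρ ε, lt_min hρ hε, β, fun y hy => ⟨(hβ y (hmem y hy 0 h0).1.1).1, fun t ht => ⟨?_, ?_⟩⟩,
    hβc.mono fun p hp => (hmem p.1 hp.1 p.2 hp.2).1⟩
  · exact ((hβ y (hmem y hy t ht).1.1).2 t (hmem y hy t ht).1.2).hasDerivAt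
      (Icc_mem_nhds (by linarith [ht.1, min_le_right ρ ε]) (ht.2.trans_le (min_le_right _ _)))
  · exact (hmem y hy t ht).2

omit [IsManifold (𝓡 n) ∞ M] in
theorem coordField_extChartAt (X : (q : M) → TangentSpace (𝓡 n) q) {x₀ q : M}
    (hq : q ∈ (extChartAt (𝓡 n) x₀).source) :
    coordField X x₀ (extChartAt (𝓡 n) x₀ q)
      = mfderiv (𝓡 n) 𝓘(ℝ, Model n) (extChartAt (𝓡 n) x₀) q (X q) := by
  unfold coordField
  rw [(extChartAt (𝓡 n) x₀).left_inv hq]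

theorem exists_local_flow {X : (q : M) → TangentSpace (𝓡 n) q}
    (hX : ContMDiff (𝓡 n) (𝓡 n).tangent ∞ (toTangent X)) (x₀ : M) :
    ∃ U ∈ 𝓝 x₀, ∃ ε > 0, ∃ Ψ : M → ℝ → M,
      (∀ x ∈ U, Ψ x 0 = x ∧ IsMIntegralCurveOn (I := 𝓡 n) (Ψ x) X (Ioo (-ε) ε)) ∧
      ∀ t ∈ Ioo (-ε) ε, ContinuousOn (fun x => Ψ x t) U := by
  have hT : (extChartAt (𝓡 n) x₀).target ∈ 𝓝 (extChartAt (𝓡 n) x₀ x₀) :=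
    extChartAt_target_mem_nhds x₀
  have hξ : ContDiffAt ℝ 1 (coordField X x₀) (extChartAt (𝓡 n) x₀ x₀) :=
    ((contDiffOn_coordField hX x₀).contDiffAt hT).of_le (by simp)
  obtain ⟨δ, hδ, β, hβ, hβc⟩ := hξ.exists_continuousOn_local_flow hT
  refine ⟨(extChartAt (𝓡 n) x₀).source ∩
      extChartAt (𝓡 n) x₀ ⁻¹' Metric.ball (extChartAt (𝓡 n) x₀ x₀) δ, ?_, δ, hδ,
    fun x t => (extChartAt (𝓡 n) x₀).symm (β (extChartAt (𝓡 n) x₀ x, t)),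
    fun x hx => ⟨?_, fun t ht => ?_⟩, fun t ht => ?_⟩
  · exact Filter.inter_mem (extChartAt_source_mem_nhds x₀)
      ((continuousAt_extChartAt x₀).preimage_mem_nhds (Metric.ball_mem_nhds _ hδ))
  · simp only [(hβ _ hx.2).1, (extChartAt (𝓡 n) x₀).left_inv hx.1]
  · obtain ⟨h1, h2⟩ := (hβ _ hx.2).2 t ht
    have h3 := hasMFDerivAt_ofCoord h1 h2
    rw [ofCoord_coordField X h2] at h3
    exact h3.hasMFDerivWithinAt
  · refine (continuousOn_extChartAt_symm x₀).comp (hβc.comp (ContinuousOn.prodMk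
      ((continuousOn_extChartAt x₀).mono inter_subset_left) continuousOn_const) ?_) ?_
    · exact fun x hx => ⟨hx.2, ht⟩
    · exact fun x hx => ((hβ _ hx.2).2 t ht).2

variable [CompactSpace M]

/-- Finitely many local flow boxes cover `M`, so the least of their existence times serves
everywhere. This bound is what makes integral curves extend to all of `ℝ`. -/
theorem exists_uniform_flow {X : (q : M) → TangentSpace (𝓡 n) q}
    (hX : ContMDiff (𝓡 n) (𝓡 n).tangent ∞ (toTangent X)) :
    ∃ ε > 0, ∀ x₀ : M, ∃ U ∈ 𝓝 x₀, ∃ Ψ : M → ℝ → M,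
      (∀ x ∈ U, Ψ x 0 = x ∧ IsMIntegralCurveOn (I := 𝓡 n) (Ψ x) X (Ioo (-ε) ε)) ∧
      ∀ t ∈ Ioo (-ε) ε, ContinuousOn (fun x => Ψ x t) U := by
  choose U hU ε hε Ψ hΨ hc using exists_local_flow hX
  obtain ⟨s, hs⟩ := CompactSpace.elim_nhds_subcover (fun x => interior (U x))
    (fun x => interior_mem_nhds.2 (hU x))
  obtain ⟨δ, hδ, hle⟩ : ∃ δ > 0, ∀ x ∈ s, δ ≤ ε x := by
    rcases s.eq_empty_or_nonempty with rfl | hne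
    · exact ⟨1, one_pos, by simp⟩
    · obtain ⟨x, hx, hmin⟩ := s.exists_min_image ε hne
      exact ⟨ε x, hε x, hmin⟩
  refine ⟨δ, hδ, fun x₀ => ?_⟩
  have hx₀ : x₀ ∈ ⋃ x ∈ s, interior (U x) := hs ▸ mem_univ x₀
  simp only [mem_iUnion] at hx₀
  obtain ⟨x, hxs, hx⟩ := hx₀
  have hsub : Ioo (-δ) δ ⊆ Ioo (-ε x) (ε x) :=
    Ioo_subset_Ioo (neg_le_neg (hle x hxs)) (hle x hxs)
  exact ⟨U x, mem_interior_iff_mem_nhds.1 hx, Ψ x,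
    fun y hy => ⟨(hΨ x y hy).1, (hΨ x y hy).2.mono hsub⟩, fun t ht => hc x t (hsub ht)⟩

variable [T2Space M]

theorem exists_integralCurve {X : (q : M) → TangentSpace (𝓡 n) q}
    (hX : ContMDiff (𝓡 n) (𝓡 n).tangent ∞ (toTangent X)) (q : M) :
    ∃ γ : ℝ → M, IsMIntegralCurve (I := 𝓡 n) γ X ∧ γ 0 = q := by
  obtain ⟨ε, hε, h⟩ := exists_uniform_flow hX
  obtain ⟨γ, h0, hγ⟩ := exists_isMIntegralCurve_of_isMIntegralCurveOn (I := 𝓡 n) (v := X)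
    (hX.of_le (by simp)) hε (fun x => by
      obtain ⟨U, hU, Ψ, hΨ, -⟩ := h x
      exact ⟨Ψ x, hΨ x (mem_of_mem_nhds hU)⟩) q
  exact ⟨γ, hγ, h0⟩

theorem isMIntegralCurve_flow {X : (q : M) → TangentSpace (𝓡 n) q}
    (hX : ContMDiff (𝓡 n) (𝓡 n).tangent ∞ (toTangent X)) (q : M) :
    IsMIntegralCurve (I := 𝓡 n) (fun t => flow X t q) X := by
  have h := exists_integralCurve hX q
  have : (fun t => flow X t q) = h.choose := by
    funext t
    simp only [flow, dif_pos h]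
  rw [this]
  exact h.choose_spec.1

theorem flow_zero {X : (q : M) → TangentSpace (𝓡 n) q}
    (hX : ContMDiff (𝓡 n) (𝓡 n).tangent ∞ (toTangent X)) (q : M) : flow X 0 q = q := by
  have h := exists_integralCurve hX q
  simp only [flow, dif_pos h]
  exact h.choose_spec.2

omit [CompactSpace M] in
theorem integralCurve_unique {X : (q : M) → TangentSpace (𝓡 n) q}
    (hX : ContMDiff (𝓡 n) (𝓡 n).tangent ∞ (toTangent X)) {γ σ : ℝ → M}
    (hγ : IsMIntegralCurve (I := 𝓡 n) γ X) (hσ : IsMIntegralCurve (I := 𝓡 n) σ X) {t : ℝ}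
    (h : γ t = σ t) : γ = σ :=
  isMIntegralCurve_Ioo_eq_of_contMDiff_boundaryless (I := 𝓡 n) (hX.of_le (by simp)) hγ hσ h

theorem integralCurve_eq_flow {X : (q : M) → TangentSpace (𝓡 n) q}
    (hX : ContMDiff (𝓡 n) (𝓡 n).tangent ∞ (toTangent X)) {γ : ℝ → M}
    (hγ : IsMIntegralCurve (I := 𝓡 n) γ X) (t : ℝ) : γ t = flow X t (γ 0) :=
  congrFun (integralCurve_unique hX hγ (isMIntegralCurve_flow hX (γ 0))
    (flow_zero hX (γ 0)).symm) t

theorem flow_add {X : (q : M) → TangentSpace (𝓡 n) q}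
    (hX : ContMDiff (𝓡 n) (𝓡 n).tangent ∞ (toTangent X)) (s t : ℝ) (q : M) :
    flow X (t + s) q = flow X t (flow X s q) := by
  have h := integralCurve_eq_flow hX ((isMIntegralCurve_flow hX q).comp_add s) t
  simpa using h

/-- For small times uniqueness identifies the flow with the continuous local flows; a general time
is reached by iterating a small one. -/
theorem continuous_flow {X : (q : M) → TangentSpace (𝓡 n) q}
    (hX : ContMDiff (𝓡 n) (𝓡 n).tangent ∞ (toTangent X)) (t : ℝ) :
    Continuous (flow X t) := by
  obtain ⟨ε, hε, h⟩ := exists_uniform_flow hX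
  have hsmall : ∀ t ∈ Ioo (-ε) ε, Continuous (flow X t) := by
    intro t ht
    rw [continuous_iff_continuousAt]
    intro x₀
    obtain ⟨U, hU, Ψ, hΨ, hc⟩ := h x₀
    refine ((hc t ht).continuousAt hU).congr ?_
    filter_upwards [hU] with x hx
    exact isMIntegralCurveOn_Ioo_eqOn_of_contMDiff_boundaryless (I := 𝓡 n) (t₀ := 0)
      (a := -ε) (b := ε) ⟨by linarith, hε⟩ (hX.of_le (by simp)) (hΨ x hx).2
      ((isMIntegralCurve_flow hX x).isMIntegralCurveOn _)
      (by simp only [(hΨ x hx).1, flow_zero hX]) ht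
  have hpow : ∀ (N : ℕ) (s : ℝ), s ∈ Ioo (-ε) ε → Continuous (flow X (N * s)) := by
    intro N s hs
    induction N with
    | zero => simpa using hsmall 0 ⟨by linarith, hε⟩
    | succ N ih =>
      have : flow X ((N + 1 : ℕ) * s) = flow X (N * s) ∘ flow X s := by
        funext q
        rw [Function.comp, ← flow_add hX]
        congr 1
        push_cast
        ring
      rw [this]
      exact ih.comp (hsmall s hs)
  obtain ⟨N, hN⟩ := exists_nat_gt (|t| / ε)
  have hN0 : (0 : ℝ) < N := lt_of_le_of_lt (by positivity) hN
  have hs : t / N ∈ Ioo (-ε) ε := by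
    rw [mem_Ioo, ← abs_lt, abs_div, abs_of_pos hN0, div_lt_iff₀ hN0]
    rwa [div_lt_iff₀ hε, mul_comm] at hN
  have := hpow N (t / N) hs
  rwa [mul_div_cancel₀ _ hN0.ne'] at this

/-! ### Regularity of integral curves -/

omit [CompactSpace M] [T2Space M] in
-- In a chart the curve solves an autonomous equation with smooth right-hand side, so it is as
-- smooth as the field.
theorem contMDiff_integralCurve {X : (q : M) → TangentSpace (𝓡 n) q}
    (hX : ContMDiff (𝓡 n) (𝓡 n).tangent ∞ (toTangent X)) {γ : ℝ → M}
    (hγ : IsMIntegralCurve (I := 𝓡 n) γ X) : ContMDiff 𝓘(ℝ, ℝ) (𝓡 n) ∞ γ := by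
  intro t₀
  set φ := extChartAt (𝓡 n) (γ t₀) with hφ
  have hs : γ ⁻¹' φ.source ∈ 𝓝 t₀ :=
    hγ.continuous.continuousAt.preimage_mem_nhds (extChartAt_source_mem_nhds (γ t₀))
  obtain ⟨ε, hε, hball⟩ := Metric.mem_nhds_iff.1 hs
  rw [Real.ball_eq_Ioo] at hball
  have hI : Icc (t₀ - ε / 2) (t₀ + ε / 2) ⊆ γ ⁻¹' φ.source := fun t ht =>
    hball ⟨by linarith [ht.1], by linarith [ht.2]⟩
  have hder : ∀ t ∈ Icc (t₀ - ε / 2) (t₀ + ε / 2), HasDerivAt (fun s => φ (γ s))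
      (coordField X (γ t₀) (φ (γ t))) t := by
    intro t ht
    have := hasDerivAt_extChartAt_comp (hγ t) (hI ht)
    rwa [← coordField_extChartAt X (hI ht)] at this
  have hsm : ContDiffOn ℝ ∞ (fun s => φ (γ s)) (Icc (t₀ - ε / 2) (t₀ + ε / 2)) :=
    ODE.contDiffOn_enat_Icc_of_hasDerivWithinAt (f := fun _ => coordField X (γ t₀))
      (u := φ.target) (n := ⊤)
      ((contDiffOn_coordField hX (γ t₀)).comp contDiffOn_snd (fun p hp => hp.2))
      (fun t ht => (hder t ht).hasDerivWithinAt) (fun t ht => φ.map_source (hI ht))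
  have hnh : Icc (t₀ - ε / 2) (t₀ + ε / 2) ∈ 𝓝 t₀ := Icc_mem_nhds (by linarith) (by linarith)
  have h1 : ContMDiffAt 𝓘(ℝ, ℝ) 𝓘(ℝ, Model n) ∞ (fun s => φ (γ s)) t₀ :=
    (hsm.contDiffAt hnh).contMDiffAt
  have h2 : ContMDiffAt 𝓘(ℝ, Model n) (𝓡 n) ∞ φ.symm (φ (γ t₀)) :=
    (contMDiffOn_extChartAt_symm (I := 𝓡 n) (n := ∞) (γ t₀)).contMDiffAt
      ((isOpen_extChartAt_target _).mem_nhds (mem_extChartAt_target _))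
  refine (h2.comp t₀ h1).congr_of_eventuallyEq ?_
  filter_upwards [hnh] with t ht
  exact (φ.left_inv (hI ht)).symm

end

section

/-! ### Uniqueness for Euler--Lagrange equations of magnetic type in a normed space -/

/-- Passing to the momentum `p = G(y) v - a(y)` turns the second-order equation into a first-order
system for `(y, p)` with a `C¹` right-hand side, where ODE uniqueness applies. The velocities
themselves need not be differentiable. -/
theorem magnetic_eventuallyEq {E : Type*} [NormedAddCommGroup E] [NormedSpace ℝ E] [CompleteSpace E]
    {G : E → E →L[ℝ] E →L[ℝ] ℝ} {a : E → E →L[ℝ] ℝ} {y₀ : E} (hG : ContDiffAt ℝ 2 G y₀)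
    (ha : ContDiffAt ℝ 2 a y₀) (hinv : (G y₀).IsInvertible) {y₁ y₂ v₁ v₂ : ℝ → E} {t₀ : ℝ}
    (h₁ : ∀ᶠ t in 𝓝 t₀, HasDerivAt y₁ (v₁ t) t ∧
      HasDerivAt (fun s => G (y₁ s) (v₁ s) - a (y₁ s))
        (fderiv ℝ (fun z => 1 / 2 * G z (v₁ t) (v₁ t) - a z (v₁ t)) (y₁ t)) t)
    (h₂ : ∀ᶠ t in 𝓝 t₀, HasDerivAt y₂ (v₂ t) t ∧
      HasDerivAt (fun s => G (y₂ s) (v₂ s) - a (y₂ s))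
        (fderiv ℝ (fun z => 1 / 2 * G z (v₂ t) (v₂ t) - a z (v₂ t)) (y₂ t)) t)
    (hy₁ : y₁ t₀ = y₀) (hy₂ : y₂ t₀ = y₀) (hv : v₁ t₀ = v₂ t₀) : y₁ =ᶠ[𝓝 t₀] y₂ := by
  -- Inverse Legendre transform: `W (y, p)` is the velocity with momentum `p` at `y`.
  let W : E × (E →L[ℝ] ℝ) → E := fun x => (G x.1).inverse (x.2 + a x.1)
  let F : E × (E →L[ℝ] ℝ) → E × (E →L[ℝ] ℝ) := fun x =>
    (W x, fderiv ℝ (fun z => 1 / 2 * G z (W x) (W x) - a z (W x)) x.1)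
  let p₀ : E →L[ℝ] ℝ := G y₀ (v₁ t₀) - a y₀
  have hW : ContDiffAt ℝ 2 W (y₀, p₀) := by
    have hG1 : ContDiffAt ℝ 2 (fun x : E × (E →L[ℝ] ℝ) => G x.1) (y₀, p₀) :=
      ContDiffAt.comp (y₀, p₀) (f := Prod.fst) hG contDiffAt_fst
    have hG' : ContDiffAt ℝ 2 (fun x : E × (E →L[ℝ] ℝ) => (G x.1).inverse) (y₀, p₀) :=
      ContDiffAt.comp (y₀, p₀) (g := ContinuousLinearMap.inverse) hinv.contDiffAt_map_inverse hG1
    have ha' : ContDiffAt ℝ 2 (fun x : E × (E →L[ℝ] ℝ) => a x.1) (y₀, p₀) :=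
      ContDiffAt.comp (y₀, p₀) (f := Prod.fst) ha contDiffAt_fst
    exact hG'.clm_apply (contDiffAt_snd.add ha')
  have hF : ContDiffAt ℝ 1 F (y₀, p₀) := by
    -- The derivative is taken in `z` with `W x` frozen, which costs one order of smoothness: this
    -- is why `C²` data are required.
    refine (hW.of_le (by norm_num)).prodMk ?_
    refine ContDiffAt.fderiv (n := 2)
      (f := fun x z => 1 / 2 * G z (W x) (W x) - a z (W x)) (g := Prod.fst) ?_
      contDiffAt_fst (by norm_num)
    have hW' : ContDiffAt ℝ 2 (fun q : (E × (E →L[ℝ] ℝ)) × E => W q.1) ((y₀, p₀), y₀) :=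
      ContDiffAt.comp ((y₀, p₀), y₀) (f := Prod.fst) hW contDiffAt_fst
    have hG' : ContDiffAt ℝ 2 (fun q : (E × (E →L[ℝ] ℝ)) × E => G q.2) ((y₀, p₀), y₀) :=
      ContDiffAt.comp ((y₀, p₀), y₀) (f := Prod.snd) hG contDiffAt_snd
    have ha' : ContDiffAt ℝ 2 (fun q : (E × (E →L[ℝ] ℝ)) × E => a q.2) ((y₀, p₀), y₀) :=
      ContDiffAt.comp ((y₀, p₀), y₀) (f := Prod.snd) ha contDiffAt_snd
    exact (contDiffAt_const.mul ((hG'.clm_apply hW').clm_apply hW')).sub (ha'.clm_apply hW')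
  obtain ⟨K, s, hs, hl⟩ := hF.exists_lipschitzOnWith
  -- Invertibility persists near `G y₀`, so near `t₀` the map `W` recovers the velocity from the
  -- momentum.
  have hopen : {A : E →L[ℝ] E →L[ℝ] ℝ | A.IsInvertible} ∈ 𝓝 (G y₀) := by
    obtain ⟨e, he⟩ := hinv
    rw [← he]
    exact e.nhds
  have key : ∀ y v : ℝ → E, (∀ᶠ t in 𝓝 t₀, HasDerivAt y (v t) t ∧
      HasDerivAt (fun s => G (y s) (v s) - a (y s))
        (fderiv ℝ (fun z => 1 / 2 * G z (v t) (v t) - a z (v t)) (y t)) t) → y t₀ = y₀ →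
      v t₀ = v₁ t₀ → ∀ᶠ t in 𝓝 t₀, HasDerivAt (fun t => (y t, G (y t) (v t) - a (y t)))
        (F (y t, G (y t) (v t) - a (y t))) t ∧ (y t, G (y t) (v t) - a (y t)) ∈ s := by
    intro y v h hy hv
    obtain ⟨hd1, hd2⟩ := h.self_of_nhds
    have hc : ContinuousAt (fun t => (y t, G (y t) (v t) - a (y t))) t₀ :=
      hd1.continuousAt.prodMk hd2.continuousAt
    have hval : (y t₀, G (y t₀) (v t₀) - a (y t₀)) = (y₀, p₀) := by simp only [hy, hv, p₀]
    have hs' : ∀ᶠ t in 𝓝 t₀, (y t, G (y t) (v t) - a (y t)) ∈ s :=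
      hc.preimage_mem_nhds (by rwa [hval])
    have hGc : Filter.Tendsto (fun t => G (y t)) (𝓝 t₀) (𝓝 (G y₀)) :=
      hG.continuousAt.tendsto.comp (hy ▸ hd1.continuousAt.tendsto)
    have hi : ∀ᶠ t in 𝓝 t₀, (G (y t)).IsInvertible := hGc hopen
    filter_upwards [h, hs', hi] with t ht1 ht2 ht3
    have hWt : W (y t, G (y t) (v t) - a (y t)) = v t := by
      obtain ⟨e, he⟩ := ht3
      simp only [W, sub_add_cancel, ← he, ContinuousLinearMap.inverse_equiv]
      exact e.symm_apply_apply _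
    refine ⟨?_, ht2⟩
    have := ht1.1.prodMk ht1.2
    simp only [F, hWt]
    exact this
  have := ODE_solution_unique_of_eventually (v := fun _ => F) (s := fun _ => s) (K := K)
    (Filter.Eventually.of_forall fun _ => hl) (key y₁ v₁ h₁ hy₁ rfl) (key y₂ v₂ h₂ hy₂ hv.symm)
    (by simp only [hy₁, hy₂, hv])
  filter_upwards [this] with t ht
  exact congrArg Prod.fst ht

/-- The Euler--Lagrange equation of a magnetic Lagrangian, as one equation between covectors. -/
theorem magnetic_hasDerivAt {E : Type*} [NormedAddCommGroup E] [NormedSpace ℝ E]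
    {G : E → E →L[ℝ] E →L[ℝ] ℝ} {a : E → E →L[ℝ] ℝ} {ℓ : E → E → ℝ} {y : ℝ → E} {t : ℝ} {T : Set E}
    (hT : T ∈ 𝓝 (y t)) (hG : DifferentiableAt ℝ G (y t)) (ha : DifferentiableAt ℝ a (y t))
    (hy : ContDiffAt ℝ 2 y t) (hsymm : ∀ z u w, G z u w = G z w u)
    (hℓ : ∀ z ∈ T, ∀ w, ℓ z w = 1 / 2 * G z w w - a z w)
    (hEL : ∀ u, HasDerivAt (fun s => fderiv ℝ (ℓ (y s)) (deriv y s) u)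
      (fderiv ℝ (fun z => ℓ z (deriv y t)) (y t) u) t) :
    HasDerivAt y (deriv y t) t ∧ HasDerivAt (fun s => G (y s) (deriv y s) - a (y s))
      (fderiv ℝ (fun z => 1 / 2 * G z (deriv y t) (deriv y t) - a z (deriv y t)) (y t)) t := by
  have hyd : DifferentiableAt ℝ y t := hy.differentiableAt (by norm_num)
  have hvd : DifferentiableAt ℝ (deriv y) t := by
    have h1 : ContDiffAt ℝ 1 (fderiv ℝ y) t := hy.fderiv_right (by norm_num)
    have h2 : ContDiffAt ℝ 1 (deriv y) t := h1.clm_apply contDiffAt_const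
    exact h2.differentiableAt (by norm_num)
  refine ⟨hyd.hasDerivAt, ?_⟩
  have hGy : DifferentiableAt ℝ (fun s => G (y s)) t :=
    DifferentiableAt.comp (g := G) (f := y) t hG hyd
  have hP : DifferentiableAt ℝ (fun s => G (y s) (deriv y s) - a (y s)) t :=
    (hGy.clm_apply hvd).sub (ha.comp t hyd)
  suffices h : fderiv ℝ (fun z => 1 / 2 * G z (deriv y t) (deriv y t) - a z (deriv y t)) (y t)
      = deriv (fun s => G (y s) (deriv y s) - a (y s)) t by
    rw [h]
    exact hP.hasDerivAt
  refine ContinuousLinearMap.ext fun u => ?_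
  have h1 := hP.hasDerivAt.clm_apply (hasDerivAt_const t u)
  simp only [map_zero, add_zero] at h1
  -- By symmetry of `G`, the fiber derivative of `ℓ` is `G v - a`.
  have hev : (fun s => fderiv ℝ (ℓ (y s)) (deriv y s) u) =ᶠ[𝓝 t] fun s =>
      (G (y s) (deriv y s) - a (y s)) u := by
    filter_upwards [hyd.continuousAt.preimage_mem_nhds hT] with s hs
    rw [funext (hℓ (y s) hs)]
    have hq := (((G (y s)).hasFDerivAt (x := deriv y s)).clm_apply
      (hasFDerivAt_id (deriv y s))).const_mul (1 / 2 : ℝ)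
    have hl := (a (y s)).hasFDerivAt (x := deriv y s)
    have hd : fderiv ℝ (fun w => 1 / 2 * G (y s) w w - a (y s) w) (deriv y s) = _ :=
      (hq.sub hl).fderiv
    rw [hd]
    have := hsymm (y s) (deriv y s) u
    simp [this]
    ring
  have h3 := (h1.congr_of_eventuallyEq hev).unique (hEL u)
  have hev2 : (fun z => ℓ z (deriv y t)) =ᶠ[𝓝 (y t)]
      fun z => 1 / 2 * G z (deriv y t) (deriv y t) - a z (deriv y t) := by
    filter_upwards [hT] with z hz
    exact hℓ z hz _
  rw [h3, hev2.fderiv_eq]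

/-! ### The metric in coordinates -/

/-- The derivative of the inverse of the chart at `x₀`. -/
def chartDeriv (x₀ : M) (y : Model n) :
    Model n →L[ℝ] TangentSpace (𝓡 n) ((extChartAt (𝓡 n) x₀).symm y) :=
  mfderiv 𝓘(ℝ, Model n) (𝓡 n) (extChartAt (𝓡 n) x₀).symm y

/-- The coefficients of the metric in the chart at `x₀`. -/
def coordMetric (g : Metric n M) (x₀ : M) (y : Model n) : Model n →L[ℝ] Model n →L[ℝ] ℝ :=
  let B : Model n →L[ℝ] Model n →L[ℝ] ℝ := g.inner ((extChartAt (𝓡 n) x₀).symm y)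
  let A : Model n →L[ℝ] Model n := chartDeriv x₀ y
  B.bilinearComp A A

theorem coordMetric_symm (g : Metric n M) (x₀ : M) (y u w : Model n) :
    coordMetric g x₀ y u w = coordMetric g x₀ y w u :=
  g.symm _ _ _

theorem contDiffOn_coordMetric (g : Metric n M) (x₀ : M) :
    ContDiffOn ℝ ∞ (coordMetric g x₀) (extChartAt (𝓡 n) x₀).target := by
  rw [contDiffOn_clm_apply]
  intro u
  rw [contDiffOn_clm_apply]
  intro w y hy
  have hs : ∀ w : Model n, ContMDiffAt 𝓘(ℝ, Model n) (𝓡 n).tangent ∞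
      (fun y => ofCoord x₀ y w) y := by
    intro w
    have h1 : ContMDiffAt 𝓘(ℝ, Model n × Model n) (𝓡 n).tangent ∞
        (fun p : Model n × Model n => ofCoord x₀ p.1 p.2) (y, w) :=
      (contMDiffOn_ofCoord x₀).contMDiffAt
        (prod_mem_nhds ((isOpen_extChartAt_target x₀).mem_nhds hy) Filter.univ_mem)
    have h2 : ContMDiffAt 𝓘(ℝ, Model n) 𝓘(ℝ, Model n × Model n) ∞ (fun y : Model n => (y, w)) y :=
      (contDiffAt_id.prodMk contDiffAt_const).contMDiffAt
    exact h1.comp y h2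
  exact (contMDiffAt_inner g (hs u) (hs w)).contDiffAt.contDiffWithinAt

/-- Positive definiteness gives injectivity and `exists_dual` gives surjectivity, both transported
by the chart derivative. -/
theorem isInvertible_coordMetric (g : Metric n M) {x₀ : M} {y : Model n}
    (hy : y ∈ (extChartAt (𝓡 n) x₀).target) : (coordMetric g x₀ y).IsInvertible := by
  have hinj : Function.Injective (coordMetric g x₀ y) := by
    rw [injective_iff_map_eq_zero]
    intro w hw
    by_contra h
    have h1 : chartDeriv x₀ y w ≠ 0 := by
      intro h0
      apply h
      have := mfderiv_mfderiv_symm hy w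
      rw [show mfderiv 𝓘(ℝ, Model n) (𝓡 n) (extChartAt (𝓡 n) x₀).symm y w = 0 from h0, map_zero]
        at this
      exact this.symm
    have h2 := g.pos _ _ h1
    have h3 : coordMetric g x₀ y w w = 0 := by rw [hw]; rfl
    exact h2.ne' h3
  have hsurj : Function.Surjective (coordMetric g x₀ y) := by
    intro p
    let B : TangentSpace (𝓡 n) ((extChartAt (𝓡 n) x₀).symm y) →L[ℝ] Model n :=
      mfderiv (𝓡 n) 𝓘(ℝ, Model n) (extChartAt (𝓡 n) x₀) ((extChartAt (𝓡 n) x₀).symm y)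
    obtain ⟨w, hw⟩ := exists_dual g ((extChartAt (𝓡 n) x₀).symm y) (p.comp B)
    refine ⟨B w, ContinuousLinearMap.ext fun v => ?_⟩
    have h1 : chartDeriv x₀ y (B w) = w := mfderiv_symm_mfderiv hy w
    have h2 : B (chartDeriv x₀ y v) = v := mfderiv_mfderiv_symm hy v
    have h3 := hw (chartDeriv x₀ y v)
    change g.inner _ (chartDeriv x₀ y (B w)) (chartDeriv x₀ y v) = p v
    rw [h1, h3]
    change p (B (chartDeriv x₀ y v)) = p v
    rw [h2]
  exact ⟨ContinuousLinearEquiv.ofBijective (coordMetric g x₀ y)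
    (LinearMap.ker_eq_bot.2 hinj) (LinearMap.range_eq_top.2 hsurj), rfl⟩

/-- Brings `L` to the form handled by the normed-space lemmas, the magnetic covector being the
metric dual of the coordinate expression of `X`. -/
theorem localLagrangian_eq (g : Metric n M) (α : (q : M) → TangentSpace (𝓡 n) q →L[ℝ] ℝ)
    {x₀ : M} {y : Model n} (hy : y ∈ (extChartAt (𝓡 n) x₀).target) (w : Model n) :
    localLagrangian (magneticLagrangian g α) x₀ y w = 1 / 2 * coordMetric g x₀ y w w
      - coordMetric g x₀ y (coordField (dualField g α) x₀ y) w := by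
  have h1 : chartDeriv x₀ y (coordField (dualField g α) x₀ y)
      = dualField g α ((extChartAt (𝓡 n) x₀).symm y) := mfderiv_symm_mfderiv hy _
  have h2 : coordMetric g x₀ y (coordField (dualField g α) x₀ y) w
      = α ((extChartAt (𝓡 n) x₀).symm y) (chartDeriv x₀ y w) := by
    change g.inner _ (chartDeriv x₀ y (coordField (dualField g α) x₀ y)) (chartDeriv x₀ y w) = _
    rw [h1]
    exact sharp_spec g _ _ _
  rw [h2]
  rfl

/-- The Euler--Lagrange equation of a magnetic Lagrangian in coordinates. -/
theorem IsEulerLagrange.hasDerivAt {g : Metric n M} {α : (q : M) → TangentSpace (𝓡 n) q →L[ℝ] ℝ}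
    (hX : ContMDiff (𝓡 n) (𝓡 n).tangent ∞ (toTangent (dualField g α))) {γ : ℝ → M}
    (hγ : IsEulerLagrange (magneticLagrangian g α) γ) {x₀ : M} {t : ℝ}
    (ht : γ t ∈ (extChartAt (𝓡 n) x₀).source) {y : ℝ → Model n}
    (hy : y = fun s => extChartAt (𝓡 n) x₀ (γ s)) :
    HasDerivAt y (deriv y t) t ∧
    HasDerivAt (fun s => coordMetric g x₀ (y s) (deriv y s)
        - coordMetric g x₀ (y s) (coordField (dualField g α) x₀ (y s)))
      (fderiv ℝ (fun z => 1 / 2 * coordMetric g x₀ z (deriv y t) (deriv y t)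
        - coordMetric g x₀ z (coordField (dualField g α) x₀ z) (deriv y t)) (y t)) t := by
  obtain ⟨hC, hEL⟩ := hγ
  have hyT : y t ∈ (extChartAt (𝓡 n) x₀).target := by
    rw [hy]; exact (extChartAt (𝓡 n) x₀).map_source ht
  have hTn := (isOpen_extChartAt_target (I := 𝓡 n) x₀).mem_nhds hyT
  have hyC : ContDiffAt ℝ 2 y t := by
    rw [hy]
    exact ((contMDiffAt_extChartAt' (n := 2) (by rwa [extChartAt_source] at ht)).comp t
      hC.contMDiffAt).contDiffAt
  have hGd : DifferentiableAt ℝ (coordMetric g x₀) (y t) :=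
    ((contDiffOn_coordMetric g x₀).contDiffAt hTn).differentiableAt (by simp)
  have had : DifferentiableAt ℝ
      (fun z => coordMetric g x₀ z (coordField (dualField g α) x₀ z)) (y t) :=
    (((contDiffOn_coordMetric g x₀).clm_apply
      (contDiffOn_coordField hX x₀)).contDiffAt hTn).differentiableAt (by simp)
  refine magnetic_hasDerivAt hTn hGd had hyC (coordMetric_symm g x₀)
    (fun z hz w => localLagrangian_eq g α hz w) fun u => ?_
  have h2 := hEL x₀ t ht u
  rw [← hy] at h2
  subst hy
  exact h2

end

section

theorem two_le_infty : (2 : WithTop ℕ∞) ≤ ∞ := by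
  exact ENat.LEInfty.out

/-! ### Minimizers of the magnetic Lagrangian -/

theorem continuous_conorm {g : Metric n M} {α : (q : M) → TangentSpace (𝓡 n) q →L[ℝ] ℝ}
    (hX : ContMDiff (𝓡 n) (𝓡 n).tangent ∞ (toTangent (dualField g α))) :
    Continuous fun q => conorm g q (α q) := by
  have h : ContMDiff (𝓡 n) 𝓘(ℝ, ℝ) ∞
      (fun q => g.inner q (dualField g α q) (dualField g α q)) :=
    fun q => contMDiffAt_inner g hX.contMDiffAt hX.contMDiffAt
  exact h.continuous.sqrt

section Compact

variable [CompactSpace M]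

theorem conorm_le_supNorm {g : Metric n M} {α : (q : M) → TangentSpace (𝓡 n) q →L[ℝ] ℝ}
    (hX : ContMDiff (𝓡 n) (𝓡 n).tangent ∞ (toTangent (dualField g α))) (q : M) :
    conorm g q (α q) ≤ supNorm g α :=
  le_ciSup (isCompact_range (continuous_conorm hX)).bddAbove q

theorem conorm_sq_le {g : Metric n M} {α : (q : M) → TangentSpace (𝓡 n) q →L[ℝ] ℝ}
    (hX : ContMDiff (𝓡 n) (𝓡 n).tangent ∞ (toTangent (dualField g α))) (q : M) :
    conorm g q (α q) ^ 2 ≤ supNorm g α ^ 2 :=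
  pow_le_pow_left₀ (conorm_nonneg g q _) (conorm_le_supNorm hX q) 2

theorem maxSet_nonempty [Nonempty M] {g : Metric n M}
    {α : (q : M) → TangentSpace (𝓡 n) q →L[ℝ] ℝ}
    (hX : ContMDiff (𝓡 n) (𝓡 n).tangent ∞ (toTangent (dualField g α))) :
    (maxSet g α).Nonempty := by
  obtain ⟨q, -, hq⟩ := isCompact_univ.exists_isMaxOn (univ_nonempty (α := M))
    (continuous_conorm hX).continuousOn
  have h : supNorm g α = conorm g q (α q) :=
    le_antisymm (ciSup_le fun x => hq (mem_univ x)) (conorm_le_supNorm hX q)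
  refine ⟨q, ?_⟩
  simp only [maxSet, mem_ofPred_eq, h]

omit [CompactSpace M] in
theorem isClosed_maxSet {g : Metric n M} {α : (q : M) → TangentSpace (𝓡 n) q →L[ℝ] ℝ}
    (hX : ContMDiff (𝓡 n) (𝓡 n).tangent ∞ (toTangent (dualField g α))) :
    IsClosed (maxSet g α) :=
  isClosed_eq (continuous_const.mul ((continuous_conorm hX).pow 2)) continuous_const

theorem neg_le_magneticLagrangian {g : Metric n M} {α : (q : M) → TangentSpace (𝓡 n) q →L[ℝ] ℝ}
    (hX : ContMDiff (𝓡 n) (𝓡 n).tangent ∞ (toTangent (dualField g α)))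
    (z : TangentBundle (𝓡 n) M) : -(1 / 2 * supNorm g α ^ 2) ≤ magneticLagrangian g α z := by
  rw [magneticLagrangian_eq]
  have h1 := inner_self_nonneg g z.1 (z.2 - dualField g α z.1)
  have h2 := conorm_sq_le hX z.1
  linarith

/-- The magnetic Lagrangian attains its minimum exactly at the vectors `X q`, `q ∈ M_α`. -/
theorem magneticLagrangian_eq_neg_iff {g : Metric n M}
    {α : (q : M) → TangentSpace (𝓡 n) q →L[ℝ] ℝ}
    (hX : ContMDiff (𝓡 n) (𝓡 n).tangent ∞ (toTangent (dualField g α)))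
    (z : TangentBundle (𝓡 n) M) : magneticLagrangian g α z = -(1 / 2 * supNorm g α ^ 2) ↔
      z ∈ toTangent (dualField g α) '' maxSet g α := by
  have h2 := conorm_sq_le hX z.1
  constructor
  · intro h
    rw [magneticLagrangian_eq] at h
    have h1 := inner_self_nonneg g z.1 (z.2 - dualField g α z.1)
    have h3 : z.2 - dualField g α z.1 = 0 := by
      by_contra h0
      have := g.pos _ _ h0
      linarith
    refine ⟨z.1, ?_, ?_⟩
    · simp only [maxSet, mem_ofPred_eq]
      linarith
    · rw [toTangent, ← sub_eq_zero.1 h3]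
  · rintro ⟨q, hq, rfl⟩
    rw [magneticLagrangian_eq]
    have h0 : (toTangent (dualField g α) q).2 - dualField g α (toTangent (dualField g α) q).1 = 0 :=
      sub_self (dualField g α q)
    rw [h0, map_zero, mul_zero, zero_sub, neg_inj]
    exact hq

/-! ### Orbits in the maximal set solve the Euler--Lagrange equation -/

omit [IsManifold (𝓡 n) ∞ M] [CompactSpace M] in
theorem IsMIntegralCurve.lift_eq {X : (q : M) → TangentSpace (𝓡 n) q} {γ : ℝ → M}
    (hγ : IsMIntegralCurve (I := 𝓡 n) γ X) (t : ℝ) : lift γ t = toTangent X (γ t) :=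
  lift_eq_of_hasMFDerivAt (hγ t)

theorem isEulerLagrange_of_mem_maxSet {g : Metric n M}
    {α : (q : M) → TangentSpace (𝓡 n) q →L[ℝ] ℝ}
    (hX : ContMDiff (𝓡 n) (𝓡 n).tangent ∞ (toTangent (dualField g α))) {γ : ℝ → M}
    (hγ : IsMIntegralCurve (I := 𝓡 n) γ (dualField g α)) (hmem : ∀ t, γ t ∈ maxSet g α) :
    IsEulerLagrange (magneticLagrangian g α) γ := by
  refine ⟨(contMDiff_integralCurve hX hγ).of_le two_le_infty, fun x₀ t ht u => ?_⟩
  have hval : ∀ s, γ s ∈ (extChartAt (𝓡 n) x₀).source →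
      localLagrangian (magneticLagrangian g α) x₀ (extChartAt (𝓡 n) x₀ (γ s))
        (deriv (fun r : ℝ => extChartAt (𝓡 n) x₀ (γ r)) s) = -(1 / 2 * supNorm g α ^ 2) := by
    intro s hs
    change magneticLagrangian g α (ofCoord x₀ _ _) = _
    rw [ofCoord_deriv (hγ s).mdifferentiableAt hs, IsMIntegralCurve.lift_eq hγ,
      magneticLagrangian_eq_neg_iff hX]
    exact mem_image_of_mem _ (hmem s)
  -- No chart condition on `y` is needed: the left side is bounded by a value of `L` at some tangent
  -- vector in every case.
  have hmin : ∀ y w, -(1 / 2 * supNorm g α ^ 2)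
      ≤ localLagrangian (magneticLagrangian g α) x₀ y w :=
    fun y w => neg_le_magneticLagrangian hX _
  have h1 : fderiv ℝ (fun y => localLagrangian (magneticLagrangian g α) x₀ y
      (deriv (fun r : ℝ => extChartAt (𝓡 n) x₀ (γ r)) t)) (extChartAt (𝓡 n) x₀ (γ t)) = 0 := by
    refine IsLocalMin.fderiv_eq_zero (Filter.Eventually.of_forall fun y => ?_)
    beta_reduce
    rw [hval t ht]
    exact hmin _ _
  have h2 : (fun s : ℝ => fderiv ℝ (localLagrangian (magneticLagrangian g α) x₀
      (extChartAt (𝓡 n) x₀ (γ s))) (deriv (fun r : ℝ => extChartAt (𝓡 n) x₀ (γ r)) s) u)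
      =ᶠ[𝓝 t] fun _ => 0 := by
    filter_upwards [hγ.continuous.continuousAt.preimage_mem_nhds
      ((isOpen_extChartAt_source x₀).mem_nhds ht)] with s hs
    have : fderiv ℝ (localLagrangian (magneticLagrangian g α) x₀
      (extChartAt (𝓡 n) x₀ (γ s))) (deriv (fun r : ℝ => extChartAt (𝓡 n) x₀ (γ r)) s) = 0 := by
      refine IsLocalMin.fderiv_eq_zero (Filter.Eventually.of_forall fun w => ?_)
      rw [hval s hs]
      exact hmin _ _
    rw [this]
    rfl
  rw [h1]
  exact (hasDerivAt_const t (0 : ℝ)).congr_of_eventuallyEq h2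

omit [CompactSpace M] in
-- Taking `Y = Z = X` in the Killing identity and using `[X, X] = 0` gives `X(|X|²) = 0`. This is
-- the only place where that identity enters.
theorem conorm_sq_integralCurve {g : Metric n M} {α : (q : M) → TangentSpace (𝓡 n) q →L[ℝ] ℝ}
    (hK : IsKilling g (dualField g α)) {γ : ℝ → M}
    (hγ : IsMIntegralCurve (I := 𝓡 n) γ (dualField g α)) (s t : ℝ) :
    conorm g (γ s) (α (γ s)) ^ 2 = conorm g (γ t) (α (γ t)) ^ 2 := by
  let f : M → ℝ := fun q => g.inner q (dualField g α q) (dualField g α q)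
  have hf : ContMDiff (𝓡 n) 𝓘(ℝ, ℝ) ∞ f :=
    fun q => contMDiffAt_inner g hK.smooth.contMDiffAt hK.smooth.contMDiffAt
  have hzero : ∀ q, mfderiv (𝓡 n) 𝓘(ℝ, ℝ) f q (dualField g α q) = (0 : ℝ) := by
    intro q
    have h := hK.lieDeriv_eq_zero _ _ hK.smooth hK.smooth q
    rw [VectorField.mlieBracket_self] at h
    refine h.trans ?_
    rw [Pi.zero_apply, map_zero, map_zero, add_zero]
    rfl
  have hd : ∀ r, HasDerivAt (fun t => f (γ t)) 0 r := by
    intro r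
    let D : ℝ →L[ℝ] ℝ := (mfderiv (𝓡 n) 𝓘(ℝ, ℝ) f (γ r)).comp
      ((1 : ℝ →L[ℝ] ℝ).smulRight (dualField g α (γ r)))
    have h : HasFDerivAt (fun t => f (γ t)) D r :=
      (((hf.mdifferentiableAt (by simp)).hasMFDerivAt (x := γ r)).comp r (hγ r)).hasFDerivAt
    have h4 : D (1 : ℝ) = 0 := by
      change mfderiv (𝓡 n) 𝓘(ℝ, ℝ) f (γ r) ((1 : ℝ) • dualField g α (γ r)) = _
      rw [one_smul]
      exact hzero _
    exact h4 ▸ h.hasDerivAt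
  rw [conorm_sq, conorm_sq]
  exact is_const_of_deriv_eq_zero (fun r => (hd r).differentiableAt) (fun r => (hd r).deriv) s t

omit [CompactSpace M] in
theorem mem_maxSet_integralCurve {g : Metric n M} {α : (q : M) → TangentSpace (𝓡 n) q →L[ℝ] ℝ}
    (hK : IsKilling g (dualField g α)) {γ : ℝ → M}
    (hγ : IsMIntegralCurve (I := 𝓡 n) γ (dualField g α)) {s : ℝ} (hs : γ s ∈ maxSet g α) (t : ℝ) :
    γ t ∈ maxSet g α := by
  simp only [maxSet, mem_ofPred_eq] at hs ⊢
  rw [conorm_sq_integralCurve hK hγ t s, hs]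

/-! ### The Euler--Lagrange flow on the minimizers -/

omit [CompactSpace M] in
-- The lift is the tangent map of the curve applied to the unit field of `ℝ`.
theorem continuous_lift {γ : ℝ → M} (hγ : ContMDiff 𝓘(ℝ, ℝ) (𝓡 n) 2 γ) :
    Continuous fun t => (lift γ t : TangentBundle (𝓡 n) M) := by
  have h1 : Continuous fun t : ℝ => (⟨t, 1⟩ : TangentBundle 𝓘(ℝ, ℝ) ℝ) := by
    have : ContMDiff 𝓘(ℝ, ℝ) 𝓘(ℝ, ℝ).tangent 0
        fun t : ℝ => (⟨t, 1⟩ : TangentBundle 𝓘(ℝ, ℝ) ℝ) := by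
      intro p
      rw [contMDiffAt_totalSpace]
      refine ⟨contMDiffAt_id, ?_⟩
      simp only [trivializationAt_model_space_apply]
      exact contMDiffAt_const
    exact this.continuous
  exact (hγ.continuous_tangentMap (by norm_num)).comp h1

variable [T2Space M]

/-- An Euler--Lagrange curve which starts at a minimizer of the magnetic Lagrangian is an orbit
of the Killing field. -/
theorem IsEulerLagrange.isMIntegralCurve {g : Metric n M}
    {α : (q : M) → TangentSpace (𝓡 n) q →L[ℝ] ℝ} (hK : IsKilling g (dualField g α)) {γ : ℝ → M}
    (hγ : IsEulerLagrange (magneticLagrangian g α) γ)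
    (h0 : lift γ 0 ∈ toTangent (dualField g α) '' maxSet g α) :
    IsMIntegralCurve (I := 𝓡 n) γ (dualField g α) := by
  have hX := hK.smooth
  have hLc : Continuous fun t => magneticLagrangian g α (lift γ t) :=
    (contMDiff_magneticLagrangian g α hX).continuous.comp (continuous_lift hγ.1)
  -- The times at which the lift is a minimizer form a nonempty clopen subset of `ℝ`. Openness comes
  -- from local uniqueness.
  let S : Set ℝ := {t | magneticLagrangian g α (lift γ t) = -(1 / 2 * supNorm g α ^ 2)}
  have hclosed : IsClosed S := isClosed_eq hLc continuous_const
  have hopen : IsOpen S := by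
    rw [isOpen_iff_mem_nhds]
    intro t₀ ht₀
    obtain ⟨q, hq, hqz⟩ := (magneticLagrangian_eq_neg_iff hX _).1 ht₀
    have hq' : q = γ t₀ := congrArg TotalSpace.proj hqz
    subst hq'
    -- The `X`-orbit through `γ t₀` is also an Euler–Lagrange curve, with the same position and
    -- velocity at `t₀`.
    let σ : ℝ → M := fun t => flow (dualField g α) (t - t₀) (γ t₀)
    have hσ : IsMIntegralCurve (I := 𝓡 n) σ (dualField g α) := by
      have := (isMIntegralCurve_flow hX (γ t₀)).comp_add (-t₀)
      exact this
    have hσ0 : σ t₀ = γ t₀ := by simp only [σ, sub_self, flow_zero hX]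
    have hσmem : ∀ t, σ t ∈ maxSet g α :=
      mem_maxSet_integralCurve hK hσ (s := t₀) (by rwa [hσ0])
    have hσE := isEulerLagrange_of_mem_maxSet hX hσ hσmem
    have hsrc : (extChartAt (𝓡 n) (γ t₀)).source ∈ 𝓝 (γ t₀) := extChartAt_source_mem_nhds _
    have hγs : ∀ᶠ t in 𝓝 t₀, γ t ∈ (extChartAt (𝓡 n) (γ t₀)).source :=
      hγ.1.continuous.continuousAt.preimage_mem_nhds hsrc
    have hσs : ∀ᶠ t in 𝓝 t₀, σ t ∈ (extChartAt (𝓡 n) (γ t₀)).source :=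
      hσ.continuous.continuousAt.preimage_mem_nhds (by rwa [hσ0])
    have hT : (extChartAt (𝓡 n) (γ t₀)).target ∈ 𝓝 (extChartAt (𝓡 n) (γ t₀) (γ t₀)) :=
      extChartAt_target_mem_nhds _
    have hdγ : MDifferentiableAt 𝓘(ℝ, ℝ) (𝓡 n) γ t₀ := hγ.1.mdifferentiableAt (by norm_num)
    have hG2 : ContDiffAt ℝ 2 (coordMetric g (γ t₀)) (extChartAt (𝓡 n) (γ t₀) (γ t₀)) :=
      ((contDiffOn_coordMetric g (γ t₀)).contDiffAt hT).of_le two_le_infty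
    have ha2 : ContDiffAt ℝ 2 (fun z => coordMetric g (γ t₀) z
        (coordField (dualField g α) (γ t₀) z)) (extChartAt (𝓡 n) (γ t₀) (γ t₀)) :=
      (((contDiffOn_coordMetric g (γ t₀)).clm_apply
        (contDiffOn_coordField hX (γ t₀))).contDiffAt hT).of_le two_le_infty
    have hder : ∀ {c : ℝ → M} {v : TangentSpace (𝓡 n) (γ t₀)}, c t₀ = γ t₀ →
        MDifferentiableAt 𝓘(ℝ, ℝ) (𝓡 n) c t₀ →
        lift c t₀ = (⟨γ t₀, v⟩ : TangentBundle (𝓡 n) M) →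
        deriv (fun s => extChartAt (𝓡 n) (γ t₀) (c s)) t₀
          = mfderiv (𝓡 n) 𝓘(ℝ, Model n) (extChartAt (𝓡 n) (γ t₀)) (γ t₀) v := by
      intro c v hc hd hl
      have h1 := (hasDerivAt_extChartAt_comp hd.hasMFDerivAt_lift (x₀ := γ t₀)
        (by rw [hc]; exact mem_extChartAt_source _)).deriv
      have h2 : ∀ z : TangentBundle (𝓡 n) M, z = ⟨γ t₀, v⟩ →
          (mfderiv (𝓡 n) 𝓘(ℝ, Model n) (extChartAt (𝓡 n) (γ t₀)) z.1 z.2 : Model n)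
            = mfderiv (𝓡 n) 𝓘(ℝ, Model n) (extChartAt (𝓡 n) (γ t₀)) (γ t₀) v := by
        rintro _ rfl
        rfl
      rw [h1]
      exact h2 _ hl
    have hev := magnetic_eventuallyEq hG2 ha2
      (isInvertible_coordMetric g (mem_of_mem_nhds hT)) (t₀ := t₀)
      (hγs.mono fun t ht => hγ.hasDerivAt hX ht rfl) (hσs.mono fun t ht => hσE.hasDerivAt hX ht rfl)
      rfl (by simp only [hσ0])
      (by
        rw [hder rfl hdγ hqz.symm, hder hσ0 (hσ t₀).mdifferentiableAt
          (by rw [IsMIntegralCurve.lift_eq hσ, hσ0]; rfl)])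
    have hγσ : γ =ᶠ[𝓝 t₀] σ := by
      filter_upwards [hev, hγs, hσs] with t h1 h2 h3
      exact (extChartAt (𝓡 n) (γ t₀)).injOn h2 h3 h1
    -- Agreement on a neighborhood of each nearby `t`, not merely at `t`, is needed to compare
    -- velocities there.
    filter_upwards [hγσ.eventuallyEq_nhds] with t ht
    have hl : (lift γ t : TangentBundle (𝓡 n) M) = toTangent (dualField g α) (γ t) :=
      lift_eq_of_hasMFDerivAt (((ht.eq_of_nhds ▸ hσ t).congr_of_eventuallyEq ht))
    change magneticLagrangian g α (lift γ t) = _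
    rw [magneticLagrangian_eq_neg_iff hX, hl]
    exact mem_image_of_mem _ (ht.eq_of_nhds ▸ hσmem t)
  have huniv : S = univ := IsClopen.eq_univ ⟨hclosed, hopen⟩
    ⟨0, (magneticLagrangian_eq_neg_iff hX _).2 h0⟩
  intro t
  have ht : t ∈ S := huniv ▸ mem_univ t
  obtain ⟨q, hq, hqz⟩ := (magneticLagrangian_eq_neg_iff hX _).1 ht
  have hq' : q = γ t := congrArg TotalSpace.proj hqz
  subst hq'
  have hv : dualField g α (γ t) = mfderiv 𝓘(ℝ, ℝ) (𝓡 n) γ t (1 : ℝ) := by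
    simpa [toTangent, lift] using hqz
  rw [hv]
  exact (hγ.1.mdifferentiableAt (by norm_num)).hasMFDerivAt_lift

theorem flow_mem_maxSet {g : Metric n M} {α : (q : M) → TangentSpace (𝓡 n) q →L[ℝ] ℝ}
    (hK : IsKilling g (dualField g α)) {q : M} (hq : q ∈ maxSet g α) (t : ℝ) :
    flow (dualField g α) t q ∈ maxSet g α :=
  mem_maxSet_integralCurve hK (isMIntegralCurve_flow hK.smooth q) (s := 0)
    (by rwa [flow_zero hK.smooth]) t

/-- The flow follows an arbitrarily chosen solution; on `X(M_α)` any choice is an `X`-orbit, so its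
value is determined. -/
theorem eulerLagrangeFlow_toTangent {g : Metric n M}
    {α : (q : M) → TangentSpace (𝓡 n) q →L[ℝ] ℝ} (hK : IsKilling g (dualField g α)) {q : M}
    (hq : q ∈ maxSet g α) (t : ℝ) :
    eulerLagrangeFlow (magneticLagrangian g α) t (toTangent (dualField g α) q)
      = toTangent (dualField g α) (flow (dualField g α) t q) := by
  have hX := hK.smooth
  have hfl := isMIntegralCurve_flow hX q
  have hex : ∃ γ : ℝ → M, IsEulerLagrange (magneticLagrangian g α) γ ∧
      lift γ 0 = toTangent (dualField g α) q :=
    ⟨_, isEulerLagrange_of_mem_maxSet hX hfl (flow_mem_maxSet hK hq), by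
      rw [IsMIntegralCurve.lift_eq hfl, flow_zero hX]⟩
  obtain ⟨h1, h2⟩ := hex.choose_spec
  have h3 := h1.isMIntegralCurve hK (by rw [h2]; exact mem_image_of_mem _ hq)
  have h4 : hex.choose 0 = q := congrArg TotalSpace.proj h2
  rw [eulerLagrangeFlow, dif_pos hex, IsMIntegralCurve.lift_eq h3, integralCurve_eq_flow hX h3, h4]

theorem flow_image_maxSet {g : Metric n M} {α : (q : M) → TangentSpace (𝓡 n) q →L[ℝ] ℝ}
    (hK : IsKilling g (dualField g α)) (t : ℝ) :
    flow (dualField g α) t '' maxSet g α = maxSet g α := by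
  refine Subset.antisymm (image_subset_iff.2 fun q hq => flow_mem_maxSet hK hq t) fun q hq => ?_
  refine ⟨flow (dualField g α) (-t) q, flow_mem_maxSet hK hq _, ?_⟩
  rw [← flow_add hK.smooth, add_neg_cancel, flow_zero hK.smooth]

end Compact

end

section

/-! ### Invariant measures of continuous flows -/

section CurveMeasure

variable {Z : Type*} [TopologicalSpace Z] [MeasurableSpace Z] [BorelSpace Z]

/-- The uniform probability measure on the arc `γ (0, T]`. -/
def curveMeasure (γ : ℝ → Z) (T : ℝ) : Measure Z :=
  ((ENNReal.ofReal T)⁻¹ • volume.restrict (Ioc 0 T)).map γ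

theorem isProbabilityMeasure_curveMeasure {γ : ℝ → Z} (hγ : Continuous γ) {T : ℝ} (hT : 0 < T) :
    IsProbabilityMeasure (curveMeasure γ T) := by
  constructor
  rw [curveMeasure, Measure.map_apply hγ.measurable MeasurableSet.univ]
  simp only [preimage_univ, Measure.smul_apply, Measure.restrict_apply MeasurableSet.univ,
    univ_inter, Real.volume_Ioc, sub_zero, smul_eq_mul]
  exact ENNReal.inv_mul_cancel (by simpa using hT) ENNReal.ofReal_ne_top

theorem integral_curveMeasure {γ : ℝ → Z} (hγ : Continuous γ) {T : ℝ} (hT : 0 < T) {f : Z → ℝ}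
    (hf : Continuous f) : ∫ x, f x ∂curveMeasure γ T = T⁻¹ * ∫ t in (0 : ℝ)..T, f (γ t) := by
  rw [curveMeasure, integral_map_of_stronglyMeasurable hγ.measurable
    hf.measurable.stronglyMeasurable, integral_smul_measure, intervalIntegral.integral_of_le hT.le,
    ENNReal.toReal_inv, ENNReal.toReal_ofReal hT.le, smul_eq_mul]

/-- An open set meeting the orbit has an open time preimage meeting `(0, T)`, hence of positive
length. -/
theorem range_subset_support_curveMeasure {γ : ℝ → Z} (hγ : Continuous γ) {T : ℝ} (hT : 0 < T)
    (hper : Function.Periodic γ T) : range γ ⊆ (curveMeasure γ T).support := by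
  rintro _ ⟨s, rfl⟩
  rw [Measure.mem_support_iff_forall]
  intro U hU
  obtain ⟨V, hVU, hV, hsV⟩ := mem_nhds_iff.1 hU
  refine lt_of_lt_of_le ?_ (measure_mono hVU)
  obtain ⟨r, hr, hrs⟩ := hper.exists_mem_Ioc hT s 0
  rw [zero_add] at hr
  -- The closure covers the endpoint `r = T`.
  have hr' : r ∈ closure (Ioo 0 T) := by
    rw [closure_Ioo hT.ne]
    exact Ioc_subset_Icc_self hr
  have hne : (γ ⁻¹' V ∩ Ioo 0 T).Nonempty :=
    mem_closure_iff.1 hr' _ (hV.preimage hγ) (by rwa [mem_preimage, ← hrs])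
  have hpos : 0 < volume (γ ⁻¹' V ∩ Ioo 0 T) :=
    ((hV.preimage hγ).inter isOpen_Ioo).measure_pos volume hne
  rw [curveMeasure, Measure.map_apply hγ.measurable hV.measurableSet, Measure.smul_apply,
    Measure.restrict_apply (hV.preimage hγ).measurableSet, smul_eq_mul]
  refine ENNReal.mul_pos (by simp) (ne_of_gt (hpos.trans_le (measure_mono ?_)))
  exact inter_subset_inter_right _ Ioo_subset_Ioc_self

/-- The flow shifts time along the orbit, and the integral of a periodic function over a period does
not change under shifts. -/
theorem isInvariantProb_curveMeasure [HasOuterApproxClosed Z] {φ : ℝ → Z → Z}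
    (hφ : ∀ t, Continuous (φ t)) {γ : ℝ → Z} (hγ : Continuous γ)
    (hadd : ∀ s t, φ t (γ s) = γ (s + t)) {T : ℝ} (hT : 0 < T) (hper : Function.Periodic γ T) :
    IsInvariantProb φ (curveMeasure γ T) := by
  have hp := isProbabilityMeasure_curveMeasure hγ hT
  refine ⟨hp, fun t => ?_⟩
  have := Measure.isProbabilityMeasure_map (μ := curveMeasure γ T) (hφ t).aemeasurable
  refine ext_of_forall_integral_eq_of_IsFiniteMeasure fun f => ?_
  rw [integral_map_of_stronglyMeasurable (hφ t).measurable f.continuous.measurable.stronglyMeasurable,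
    integral_curveMeasure hγ hT f.continuous]
  have h1 := integral_curveMeasure hγ hT (f.continuous.comp (hφ t))
  simp only [Function.comp_apply] at h1
  rw [h1]
  simp only [hadd]
  have hpf : Function.Periodic (fun s => f (γ s)) T := fun s => by simp only [hper s]
  rw [intervalIntegral.integral_comp_add_right (fun s => f (γ s)), zero_add, add_comm T t,
    hpf.intervalIntegral_add_eq t 0, zero_add]

/-- **Krylov--Bogolyubov**: a continuous flow on a compact space has an invariant probability
measure, which can be chosen concentrated on the zeros of a given function that vanishes on
an orbit. -/
theorem exists_isInvariantProb [CompactSpace Z] [T2Space Z] [HasOuterApproxClosed Z]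
    {φ : ℝ → Z → Z} (hφ : ∀ t, Continuous (φ t)) {γ : ℝ → Z} (hγ : Continuous γ)
    (hadd : ∀ s t, φ t (γ s) = γ (s + t)) {F : Z → ℝ} (hF : Continuous F) (hF0 : ∀ x, 0 ≤ F x)
    (hFγ : ∀ t, F (γ t) = 0) :
    ∃ ν : Measure Z, IsInvariantProb φ ν ∧ ν {x | F x ≠ 0} = 0 := by
  have hT : ∀ k : ℕ, (0 : ℝ) < k + 1 := fun k => by positivity
  let μ : ℕ → ProbabilityMeasure Z := fun k =>
    ⟨curveMeasure γ (k + 1), isProbabilityMeasure_curveMeasure hγ (hT k)⟩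
  let U : Filter ℕ := Filter.hyperfilter ℕ
  -- Compactness of the space of probability measures gives a limit of the time averages along an
  -- ultrafilter, so no subsequence has to be extracted.
  obtain ⟨ν, -, hν⟩ := isCompact_univ.ultrafilter_le_nhds' ((Filter.hyperfilter ℕ).map μ)
    Filter.univ_mem
  have hν' : Filter.Tendsto μ U (𝓝 ν) := hν
  have hU : U ≤ Filter.atTop := Nat.hyperfilter_le_atTop
  rw [ProbabilityMeasure.tendsto_iff_forall_integral_tendsto] at hν'
  have hlim : ∀ f : BoundedContinuousFunction Z ℝ, Filter.Tendsto
      (fun k : ℕ => ((k : ℝ) + 1)⁻¹ * ∫ t in (0 : ℝ)..(k + 1), f (γ t)) U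
      (𝓝 (∫ x, f x ∂(ν : Measure Z))) := by
    intro f
    refine (hν' f).congr fun k => ?_
    exact integral_curveMeasure hγ (hT k) f.continuous
  have hk0 : Filter.Tendsto (fun k : ℕ => ((k : ℝ) + 1)⁻¹) U (𝓝 0) := by
    refine Filter.Tendsto.mono_left ?_ hU
    exact tendsto_inv_atTop_zero.comp
      (Filter.tendsto_atTop_add_const_right _ _ tendsto_natCast_atTop_atTop)
  refine ⟨ν, ⟨inferInstance, fun t => ?_⟩, ?_⟩
  · have := Measure.isProbabilityMeasure_map (μ := (ν : Measure Z)) (hφ t).aemeasurable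
    refine ext_of_forall_integral_eq_of_IsFiniteMeasure fun f => ?_
    rw [integral_map_of_stronglyMeasurable (hφ t).measurable
      f.continuous.measurable.stronglyMeasurable]
    have h1 := hlim (f.compContinuous ⟨φ t, hφ t⟩)
    have h2 := hlim f
    refine tendsto_nhds_unique h1 ?_
    have hc : Continuous fun s => f (γ s) := f.continuous.comp hγ
    have hi : ∀ a b : ℝ, IntervalIntegrable (fun s => f (γ s)) volume a b :=
      fun a b => hc.intervalIntegrable a b
    -- The averages of `f` and of `f ∘ φ t` differ by two boundary integrals over intervals of
    -- length `|t|`, divided by `k + 1`.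
    have hdiff : Filter.Tendsto (fun k : ℕ => ((k : ℝ) + 1)⁻¹ *
        ((∫ s in ((k : ℝ) + 1)..(k + 1 + t), f (γ s)) - ∫ s in (0 : ℝ)..t, f (γ s))) U (𝓝 0) := by
      refine hk0.zero_mul_isBoundedUnder_le ?_
      refine Filter.isBoundedUnder_of ⟨‖f‖ * |t| + ‖f‖ * |t|, fun k => ?_⟩
      refine (norm_sub_le _ _).trans (add_le_add ?_ ?_)
      · have := intervalIntegral.norm_integral_le_of_norm_le_const (a := (k : ℝ) + 1)
          (b := k + 1 + t) (f := fun s => f (γ s)) (C := ‖f‖) fun s _ => f.norm_coe_le_norm (γ s)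
        simpa using this
      · have := intervalIntegral.norm_integral_le_of_norm_le_const (a := (0 : ℝ))
          (b := t) (f := fun s => f (γ s)) (C := ‖f‖) fun s _ => f.norm_coe_le_norm (γ s)
        simpa using this
    have h3 := h2.add hdiff
    rw [add_zero] at h3
    refine h3.congr fun k => ?_
    rw [← mul_add]
    congr 1
    have h4 : ∀ s, (f.compContinuous ⟨φ t, hφ t⟩) (γ s) = f (γ (s + t)) := fun s => by
      simp [hadd]
    simp only [h4]
    rw [intervalIntegral.integral_comp_add_right (fun s => f (γ s)), zero_add]
    have h5 := intervalIntegral.integral_add_adjacent_intervals (hi 0 t) (hi t (k + 1 + t))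
    have h6 := intervalIntegral.integral_add_adjacent_intervals (hi 0 (k + 1)) (hi (k + 1) (k + 1 + t))
    linarith
  · have h1 := hlim (BoundedContinuousFunction.mkOfCompact ⟨F, hF⟩)
    simp only [BoundedContinuousFunction.mkOfCompact_apply, ContinuousMap.coe_mk, hFγ,
      intervalIntegral.integral_zero, mul_zero] at h1
    have h2 : ∫ x, F x ∂(ν : Measure Z) = 0 := tendsto_nhds_unique tendsto_const_nhds h1 |>.symm
    have hint : Integrable F (ν : Measure Z) :=
      (BoundedContinuousFunction.mkOfCompact ⟨F, hF⟩).integrable _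
    exact (integral_eq_zero_iff_of_nonneg hF0 hint).1 h2

end CurveMeasure

/-! ### Minimizing measures -/

variable [CompactSpace M] [T2Space M] [MeasurableSpace M] [BorelSpace M]
  [MeasurableSpace (TangentBundle (𝓡 n) M)] [BorelSpace (TangentBundle (𝓡 n) M)]

omit [CompactSpace M] [T2Space M] [BorelSpace M] [BorelSpace (TangentBundle (𝓡 n) M)] in
theorem image_mem_ae_map [OpensMeasurableSpace M] [BorelSpace (TangentBundle (𝓡 n) M)]
    {X : (q : M) → TangentSpace (𝓡 n) q}
    (hX : ContMDiff (𝓡 n) (𝓡 n).tangent ∞ (toTangent X)) {ν : Measure M} {K : Set M}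
    (hK : ν Kᶜ = 0) (hclosed : IsClosed (toTangent X '' K)) :
    toTangent X '' K ∈ ae (ν.map (toTangent X)) := by
  rw [mem_ae_iff, Measure.map_apply hX.continuous.measurable hclosed.measurableSet.compl]
  exact measure_mono_null (t := Kᶜ) (fun q hq hqK => hq (mem_image_of_mem _ hqK)) hK

omit [CompactSpace M] [T2Space M] in
-- `X` is a homeomorphism onto its image, with the bundle projection as inverse. Closedness of
-- `X(K)` ensures that the support contains no points off the graph.
theorem support_map_toTangent {X : (q : M) → TangentSpace (𝓡 n) q}
    (hX : ContMDiff (𝓡 n) (𝓡 n).tangent ∞ (toTangent X)) {ν : Measure M} {K : Set M}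
    (hK : ν Kᶜ = 0) (hclosed : IsClosed (toTangent X '' K)) :
    (ν.map (toTangent X)).support = toTangent X '' ν.support := by
  have hc : Continuous (toTangent X) := hX.continuous
  have hπ : Continuous (TotalSpace.proj : TangentBundle (𝓡 n) M → M) :=
    FiberBundle.continuous_proj (Model n) (TangentSpace (𝓡 n))
  have hae := image_mem_ae_map hX hK hclosed
  apply Subset.antisymm
  · intro z hz
    obtain ⟨q, hq, rfl⟩ := Measure.support_subset_of_isClosed hclosed hae hz
    refine mem_image_of_mem _ ?_
    rw [Measure.mem_support_iff_forall] at hz ⊢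
    intro U hU
    obtain ⟨V, hVU, hV, hqV⟩ := mem_nhds_iff.1 hU
    have h1 := hz (TotalSpace.proj ⁻¹' V) ((hV.preimage hπ).mem_nhds hqV)
    rw [Measure.map_apply hc.measurable (hV.preimage hπ).measurableSet] at h1
    exact h1.trans_le (measure_mono hVU)
  · rintro _ ⟨q, hq, rfl⟩
    rw [Measure.mem_support_iff_forall] at hq ⊢
    intro U hU
    obtain ⟨V, hVU, hV, hqV⟩ := mem_nhds_iff.1 hU
    have h1 := hq (toTangent X ⁻¹' V) ((hV.preimage hc).mem_nhds hqV)
    rw [← Measure.map_apply hc.measurable hV.measurableSet] at h1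
    exact h1.trans_le (measure_mono hVU)

omit [T2Space M] [MeasurableSpace M] [BorelSpace M] [MeasurableSpace (TangentBundle (𝓡 n) M)]
  [BorelSpace (TangentBundle (𝓡 n) M)] in
-- It is the level set of `L` at its minimum.
theorem isClosed_image_maxSet {g : Metric n M} {α : (q : M) → TangentSpace (𝓡 n) q →L[ℝ] ℝ}
    (hX : ContMDiff (𝓡 n) (𝓡 n).tangent ∞ (toTangent (dualField g α))) :
    IsClosed (toTangent (dualField g α) '' maxSet g α) := by
  have h : toTangent (dualField g α) '' maxSet g α
      = {z | magneticLagrangian g α z = -(1 / 2 * supNorm g α ^ 2)} :=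
    ext fun z => (magneticLagrangian_eq_neg_iff hX z).symm
  rw [h]
  exact isClosed_eq (contMDiff_magneticLagrangian g α hX).continuous continuous_const

omit [T2Space M] [MeasurableSpace M] [BorelSpace M] [BorelSpace (TangentBundle (𝓡 n) M)] in
-- Invariance plays no role: the bound integrates a pointwise one. Hence the behavior of `Φ_L` away
-- from the minimizers never matters.
theorem neg_le_action {g : Metric n M} {α : (q : M) → TangentSpace (𝓡 n) q →L[ℝ] ℝ}
    (hX : ContMDiff (𝓡 n) (𝓡 n).tangent ∞ (toTangent (dualField g α)))
    (μ : Measure (TangentBundle (𝓡 n) M)) [IsProbabilityMeasure μ] :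
    ((-(1 / 2 * supNorm g α ^ 2) : ℝ) : EReal) ≤ action (magneticLagrangian g α) μ := by
  unfold action
  split_ifs with h
  · rw [EReal.coe_le_coe_iff]
    have := integral_mono (integrable_const (-(1 / 2 * supNorm g α ^ 2))) h
      (neg_le_magneticLagrangian hX)
    simpa using this
  · exact le_top

omit [MeasurableSpace M] [BorelSpace M] [BorelSpace (TangentBundle (𝓡 n) M)] in
/-- Along the minimizers the Euler--Lagrange flow is conjugate to the flow of `X`. -/
theorem map_eulerLagrangeFlow {g : Metric n M} {α : (q : M) → TangentSpace (𝓡 n) q →L[ℝ] ℝ}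
    (hK : IsKilling g (dualField g α)) {μ : Measure (TangentBundle (𝓡 n) M)}
    (hμ : ∀ᵐ z ∂μ, z ∈ toTangent (dualField g α) '' maxSet g α) (t : ℝ) :
    μ.map (eulerLagrangeFlow (magneticLagrangian g α) t) = μ.map
      (toTangent (dualField g α) ∘ flow (dualField g α) t ∘ TotalSpace.proj) := by
  refine Measure.map_congr ?_
  filter_upwards [hμ] with z hz
  obtain ⟨q, hq, rfl⟩ := hz
  exact eulerLagrangeFlow_toTangent hK hq t

theorem isInvariantProb_map {g : Metric n M} {α : (q : M) → TangentSpace (𝓡 n) q →L[ℝ] ℝ}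
    (hK : IsKilling g (dualField g α)) {ν : Measure M}
    (hν : IsInvariantProb (flow (dualField g α)) ν) (hmax : ν (maxSet g α)ᶜ = 0) :
    IsInvariantProb (eulerLagrangeFlow (magneticLagrangian g α))
      (ν.map (toTangent (dualField g α))) ∧
    action (magneticLagrangian g α) (ν.map (toTangent (dualField g α)))
      = ((-(1 / 2 * supNorm g α ^ 2) : ℝ) : EReal) := by
  have hX := hK.smooth
  have hc : Continuous (toTangent (dualField g α)) := hX.continuous
  have hπ : Continuous (TotalSpace.proj : TangentBundle (𝓡 n) M → M) :=
    FiberBundle.continuous_proj (Model n) (TangentSpace (𝓡 n))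
  have := hν.1
  have hp : IsProbabilityMeasure (ν.map (toTangent (dualField g α))) :=
    Measure.isProbabilityMeasure_map hc.aemeasurable
  have hae : ∀ᵐ z ∂(ν.map (toTangent (dualField g α))),
      z ∈ toTangent (dualField g α) '' maxSet g α :=
    image_mem_ae_map hX hmax (isClosed_image_maxSet hX)
  refine ⟨⟨hp, fun t => ?_⟩, ?_⟩
  · have hfc := continuous_flow hX t
    rw [map_eulerLagrangeFlow hK hae, Measure.map_map (hc.comp (hfc.comp hπ)).measurable
      hc.measurable]
    change ν.map (toTangent (dualField g α) ∘ flow (dualField g α) t) = _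
    rw [← Measure.map_map hc.measurable hfc.measurable, hν.2 t]
  · have hL : magneticLagrangian g α =ᵐ[ν.map (toTangent (dualField g α))]
        fun _ => -(1 / 2 * supNorm g α ^ 2) := by
      filter_upwards [hae] with z hz
      exact (magneticLagrangian_eq_neg_iff hX z).2 hz
    rw [action, if_pos ((integrable_congr hL).2 (integrable_const _)), integral_congr_ae hL]
    simp

/-- `L + ½‖α‖_∞²` is nonnegative with integral at most zero, so it vanishes almost everywhere and
`μ` lives on the graph `X(M_α)`. There `μ` is recovered from its projection. -/
theorem exists_eq_map_of_action_le {g : Metric n M}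
    {α : (q : M) → TangentSpace (𝓡 n) q →L[ℝ] ℝ} (hK : IsKilling g (dualField g α))
    {μ : Measure (TangentBundle (𝓡 n) M)}
    (hμ : IsInvariantProb (eulerLagrangeFlow (magneticLagrangian g α)) μ)
    (hact : action (magneticLagrangian g α) μ ≤ ((-(1 / 2 * supNorm g α ^ 2) : ℝ) : EReal)) :
    ∃ ν : Measure M, IsInvariantProb (flow (dualField g α)) ν ∧ ν (maxSet g α)ᶜ = 0 ∧
      μ = ν.map (toTangent (dualField g α)) := by
  have hX := hK.smooth
  have hc : Continuous (toTangent (dualField g α)) := hX.continuous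
  have hπ : Continuous (TotalSpace.proj : TangentBundle (𝓡 n) M → M) :=
    FiberBundle.continuous_proj (Model n) (TangentSpace (𝓡 n))
  have hp := hμ.1
  have hint : Integrable (magneticLagrangian g α) μ := by
    by_contra h
    rw [action, if_neg h] at hact
    exact absurd (top_le_iff.1 hact) (EReal.coe_ne_top _)
  rw [action, if_pos hint, EReal.coe_le_coe_iff] at hact
  have hae : ∀ᵐ z ∂μ, z ∈ toTangent (dualField g α) '' maxSet g α := by
    have hnn : 0 ≤ fun z => magneticLagrangian g α z + 1 / 2 * supNorm g α ^ 2 := fun z => by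
      have := neg_le_magneticLagrangian hX z
      change 0 ≤ magneticLagrangian g α z + 1 / 2 * supNorm g α ^ 2
      linarith
    have hi2 : Integrable (fun z => magneticLagrangian g α z + 1 / 2 * supNorm g α ^ 2) μ :=
      hint.add (integrable_const _)
    have h0 : ∫ z, (magneticLagrangian g α z + 1 / 2 * supNorm g α ^ 2) ∂μ = 0 := by
      refine le_antisymm ?_ (integral_nonneg hnn)
      rw [integral_add hint (integrable_const _)]
      simp only [integral_const, probReal_univ, one_smul]
      linarith
    filter_upwards [(integral_eq_zero_iff_of_nonneg hnn hi2).1 h0] with z hz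
    rw [← magneticLagrangian_eq_neg_iff hX]
    have : magneticLagrangian g α z + 1 / 2 * supNorm g α ^ 2 = 0 := hz
    linarith
  refine ⟨μ.map TotalSpace.proj, ⟨Measure.isProbabilityMeasure_map hπ.aemeasurable,
    fun t => ?_⟩, ?_, ?_⟩
  · have hfc := continuous_flow hX t
    have h1 := hμ.2 t
    rw [map_eulerLagrangeFlow hK hae] at h1
    have h2 := congrArg (Measure.map TotalSpace.proj) h1
    rw [Measure.map_map hπ.measurable (hc.comp (hfc.comp hπ)).measurable] at h2
    rw [Measure.map_map hfc.measurable hπ.measurable]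
    exact h2
  · rw [Measure.map_apply hπ.measurable (isClosed_maxSet hX).measurableSet.compl]
    refine measure_mono_null (t := (toTangent (dualField g α) '' maxSet g α)ᶜ)
      (fun z hz hzK => hz ?_) hae
    obtain ⟨q, hq, rfl⟩ := hzK
    exact hq
  · rw [Measure.map_map hc.measurable hπ.measurable]
    conv_lhs => rw [← Measure.map_id (μ := μ)]
    refine Measure.map_congr ?_
    filter_upwards [hae] with z hz
    obtain ⟨q, hq, rfl⟩ := hz
    rfl

omit [MeasurableSpace (TangentBundle (𝓡 n) M)] [BorelSpace (TangentBundle (𝓡 n) M)] in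
theorem exists_invariant_on_maxSet [Nonempty M] {g : Metric n M}
    {α : (q : M) → TangentSpace (𝓡 n) q →L[ℝ] ℝ} (hK : IsKilling g (dualField g α)) :
    ∃ ν : Measure M, IsInvariantProb (flow (dualField g α)) ν ∧ ν (maxSet g α)ᶜ = 0 := by
  have hX := hK.smooth
  have : TopologicalSpace.MetrizableSpace M := Manifold.metrizableSpace (𝓡 n) M
  let _ := TopologicalSpace.metrizableSpaceMetric M
  obtain ⟨q, hq⟩ := maxSet_nonempty hX
  obtain ⟨ν, hν, h0⟩ := exists_isInvariantProb (φ := flow (dualField g α)) (continuous_flow hX)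
    (isMIntegralCurve_flow hX q).continuous
    (fun s t => by rw [add_comm, flow_add hX])
    -- The zero set of this nonnegative function is `M_α`, so the limit measure is concentrated
    -- there.
    (F := fun x => supNorm g α ^ 2 - conorm g x (α x) ^ 2)
    (continuous_const.sub ((continuous_conorm hX).pow 2))
    (fun x => sub_nonneg.2 (conorm_sq_le hX x))
    (fun t => by
      have := flow_mem_maxSet hK hq t
      simp only [maxSet, mem_ofPred_eq] at this
      linarith)
  refine ⟨ν, hν, measure_mono_null
    (t := {x | supNorm g α ^ 2 - conorm g x (α x) ^ 2 ≠ 0}) (fun x hx h => hx ?_) h0⟩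
  simp only [maxSet, mem_ofPred_eq]
  linarith

/-- A pushforward of an invariant measure on `M_α` exists and attains the lower bound, so being
minimal means having exactly that action. -/
theorem isActionMinimizing_iff [Nonempty M] {g : Metric n M}
    {α : (q : M) → TangentSpace (𝓡 n) q →L[ℝ] ℝ} (hK : IsKilling g (dualField g α))
    (μ : Measure (TangentBundle (𝓡 n) M)) :
    IsActionMinimizing (magneticLagrangian g α) μ ↔ ∃ ν : Measure M,
      IsInvariantProb (flow (dualField g α)) ν ∧ ν (maxSet g α)ᶜ = 0 ∧
      μ = ν.map (toTangent (dualField g α)) := by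
  constructor
  · rintro ⟨hμ, hmin⟩
    obtain ⟨ν, hν, h0⟩ := exists_invariant_on_maxSet hK
    obtain ⟨h1, h2⟩ := isInvariantProb_map hK hν h0
    exact exists_eq_map_of_action_le hK hμ (h2 ▸ hmin _ h1)
  · rintro ⟨ν, hν, h0, rfl⟩
    obtain ⟨h1, h2⟩ := isInvariantProb_map hK hν h0
    refine ⟨h1, fun ν' hν' => ?_⟩
    have := hν'.1
    rw [h2]
    exact neg_le_action hK.smooth ν'

theorem matherSet_eq [Nonempty M] {g : Metric n M}
    {α : (q : M) → TangentSpace (𝓡 n) q →L[ℝ] ℝ} (hK : IsKilling g (dualField g α)) :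
    matherSet (magneticLagrangian g α) = toTangent (dualField g α) ''
      ⋃ (ν : Measure M) (_ : IsInvariantProb (flow (dualField g α)) ν)
        (_ : ν (maxSet g α)ᶜ = 0), ν.support := by
  have hcl := isClosed_image_maxSet hK.smooth
  ext z
  simp only [matherSet, isActionMinimizing_iff hK, image_iUnion, mem_iUnion]
  constructor
  · rintro ⟨_, ⟨ν, hν, h0, rfl⟩, hz⟩
    rw [support_map_toTangent hK.smooth h0 hcl] at hz
    exact ⟨ν, hν, h0, hz⟩
  · rintro ⟨ν, hν, h0, hz⟩
    refine ⟨_, ⟨ν, hν, h0, rfl⟩, ?_⟩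
    rwa [support_map_toTangent hK.smooth h0 hcl]

theorem projectedMatherSet_eq [Nonempty M] {g : Metric n M}
    {α : (q : M) → TangentSpace (𝓡 n) q →L[ℝ] ℝ} (hK : IsKilling g (dualField g α)) :
    projectedMatherSet (magneticLagrangian g α) =
      ⋃ (ν : Measure M) (_ : IsInvariantProb (flow (dualField g α)) ν)
        (_ : ν (maxSet g α)ᶜ = 0), ν.support := by
  rw [projectedMatherSet, matherSet_eq hK, image_image]
  exact image_id _

/-- The uniform measure on the orbit is invariant, concentrated on `M_α`, and its support contains
the orbit. `T` need not be the least period, so rest points are included. -/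
theorem periodic_subset_projectedMatherSet [Nonempty M] {g : Metric n M}
    {α : (q : M) → TangentSpace (𝓡 n) q →L[ℝ] ℝ} (hK : IsKilling g (dualField g α)) {γ : ℝ → M}
    (hγ : IsMIntegralCurve (I := 𝓡 n) γ (dualField g α)) (h0 : γ 0 ∈ maxSet g α) {T : ℝ}
    (hT : 0 < T) (hper : Function.Periodic γ T) :
    range γ ⊆ projectedMatherSet (magneticLagrangian g α) := by
  have hX := hK.smooth
  have : TopologicalSpace.MetrizableSpace M := Manifold.metrizableSpace (𝓡 n) M
  let _ := TopologicalSpace.metrizableSpaceMetric M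
  rw [projectedMatherSet_eq hK]
  have hinv : IsInvariantProb (flow (dualField g α)) (curveMeasure γ T) := by
    refine isInvariantProb_curveMeasure (continuous_flow hX) hγ.continuous (fun s t => ?_) hT hper
    rw [integralCurve_eq_flow hX hγ s, integralCurve_eq_flow hX hγ (s + t), add_comm, flow_add hX]
  have hnull : curveMeasure γ T (maxSet g α)ᶜ = 0 := by
    have he : γ ⁻¹' (maxSet g α)ᶜ = ∅ :=
      eq_empty_of_forall_notMem fun t ht => ht (mem_maxSet_integralCurve hK hγ h0 t)
    rw [curveMeasure, Measure.map_apply hγ.continuous.measurable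
      (isClosed_maxSet hX).measurableSet.compl, he, measure_empty]
  refine (range_subset_support_curveMeasure hγ.continuous hT hper).trans fun x hx => ?_
  simp only [mem_iUnion]
  exact ⟨_, hinv, hnull, hx⟩

theorem maneValueMeasures_eq [Nonempty M] {g : Metric n M}
    {α : (q : M) → TangentSpace (𝓡 n) q →L[ℝ] ℝ} (hK : IsKilling g (dualField g α)) :
    maneValueMeasures (magneticLagrangian g α) = ((1 / 2 * supNorm g α ^ 2 : ℝ) : EReal) := by
  have h : (⨅ (μ : Measure (TangentBundle (𝓡 n) M))
      (_ : IsInvariantProb (eulerLagrangeFlow (magneticLagrangian g α)) μ),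
      action (magneticLagrangian g α) μ) = ((-(1 / 2 * supNorm g α ^ 2) : ℝ) : EReal) := by
    apply le_antisymm
    · obtain ⟨ν, hν, h0⟩ := exists_invariant_on_maxSet hK
      obtain ⟨h1, h2⟩ := isInvariantProb_map hK hν h0
      exact h2 ▸ iInf₂_le _ h1
    · refine le_iInf₂ fun μ hμ => ?_
      have := hμ.1
      exact neg_le_action hK.smooth μ
  rw [maneValueMeasures, h, ← EReal.coe_neg, neg_neg]

end

section

/-! ### The Hamiltonian description of the Mañé critical value -/

section Mane

variable [CompactSpace M] [T2Space M] [Nonempty M]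

theorem maneValueHamiltonian_eq {g : Metric n M} {α : (q : M) → TangentSpace (𝓡 n) q →L[ℝ] ℝ}
    (hK : IsKilling g (dualField g α)) :
    maneValueHamiltonian (magneticHamiltonian g α) = ((1 / 2 * supNorm g α ^ 2 : ℝ) : EReal) := by
  have hX := hK.smooth
  apply le_antisymm
  · refine (iInf_le _ (0 : C^∞⟮𝓡 n, M; 𝓘(ℝ, ℝ), ℝ⟯)).trans (iSup_le fun q => ?_)
    rw [EReal.coe_le_coe_iff]
    have h0 : mfderiv (𝓡 n) 𝓘(ℝ, ℝ) (0 : C^∞⟮𝓡 n, M; 𝓘(ℝ, ℝ), ℝ⟯) q = 0 :=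
      mfderiv_const (I := 𝓡 n) (I' := 𝓘(ℝ, ℝ)) (c := (0 : ℝ))
    have h1 : magneticHamiltonian g α q (mfderiv (𝓡 n) 𝓘(ℝ, ℝ) (0 : C^∞⟮𝓡 n, M; 𝓘(ℝ, ℝ), ℝ⟯) q)
        = 1 / 2 * conorm g q (α q) ^ 2 := by
      rw [h0]
      change 1 / 2 * conorm g q ((0 : TangentSpace (𝓡 n) q →L[ℝ] ℝ) + α q) ^ 2 = _
      rw [zero_add]
    have h2 := conorm_sq_le hX q
    exact h1.trans_le (by linarith)
  · refine le_iInf fun f => ?_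
    by_contra hlt
    obtain ⟨b, hb1, hb2⟩ := EReal.lt_iff_exists_real_btwn.1 (not_le.1 hlt)
    rw [EReal.coe_lt_coe_iff] at hb2
    let df : (q : M) → TangentSpace (𝓡 n) q →L[ℝ] ℝ := fun q => mfderiv (𝓡 n) 𝓘(ℝ, ℝ) f q
    have hb : ∀ q, magneticHamiltonian g α q (df q) ≤ b := fun q =>
      EReal.coe_le_coe_iff.1 ((le_iSup (fun q => ((magneticHamiltonian g α q
        (df q) : ℝ) : EReal)) q).trans hb1.le)
    obtain ⟨q, hq⟩ := maxSet_nonempty hX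
    have hγ := isMIntegralCurve_flow hX q
    set γ : ℝ → M := fun t => flow (dualField g α) t q with hγdef
    have hmem : ∀ t, γ t ∈ maxSet g α := fun t => flow_mem_maxSet hK hq t
    have hd : ∀ t, HasDerivAt (fun t => f (γ t))
        (df (γ t) (dualField g α (γ t))) t := by
      intro r
      let D : ℝ →L[ℝ] ℝ := (mfderiv (𝓡 n) 𝓘(ℝ, ℝ) f (γ r)).comp
        ((1 : ℝ →L[ℝ] ℝ).smulRight (dualField g α (γ r)))
      have h : HasFDerivAt (fun t => f (γ t)) D r :=
        (((f.contMDiff.mdifferentiableAt (by simp)).hasMFDerivAt (x := γ r)).comp r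
          (hγ r)).hasFDerivAt
      have h4 : D (1 : ℝ) = df (γ r) (dualField g α (γ r)) := by
        change df (γ r) ((1 : ℝ) • dualField g α (γ r)) = _
        rw [one_smul]
      exact h4 ▸ h.hasDerivAt
    -- Young's inequality for the covector `df + α` and the vector `X` gives `df(X) + |X|² ≤ b +
    -- ½|X|²`, and `|X|² = ‖α‖_∞²` on `M_α`.
    have hle : ∀ t, df (γ t) (dualField g α (γ t))
        ≤ b - 1 / 2 * supNorm g α ^ 2 := by
      intro t
      have h1 := apply_le_conorm g (γ t) (df (γ t) + α (γ t))
        (dualField g α (γ t))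
      have h2 : 1 / 2 * conorm g (γ t) (df (γ t) + α (γ t)) ^ 2 ≤ b :=
        hb (γ t)
      have h3 : 1 / 2 * conorm g (γ t) (α (γ t)) ^ 2 = 1 / 2 * supNorm g α ^ 2 := hmem t
      have h4 : g.inner (γ t) (dualField g α (γ t)) (dualField g α (γ t))
          = conorm g (γ t) (α (γ t)) ^ 2 := (conorm_sq g (γ t) (α (γ t))).symm
      have h5 : α (γ t) (dualField g α (γ t))
          = g.inner (γ t) (dualField g α (γ t)) (dualField g α (γ t)) :=
        (sharp_spec g (γ t) (α (γ t)) _).symm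
      have h6 : (df (γ t) + α (γ t)) (dualField g α (γ t))
          = df (γ t) (dualField g α (γ t))
            + α (γ t) (dualField g α (γ t)) := rfl
      rw [h6] at h1
      linarith
    have hanti : Antitone fun t => f (γ t) - (b - 1 / 2 * supNorm g α ^ 2) * t := by
      have hd' : ∀ t, HasDerivAt (fun t => f (γ t) - (b - 1 / 2 * supNorm g α ^ 2) * t)
          (df (γ t) (dualField g α (γ t))
            - (b - 1 / 2 * supNorm g α ^ 2) * 1) t :=
        fun t => (hd t).sub ((hasDerivAt_id t).const_mul _)
      refine antitone_of_deriv_nonpos (fun t => (hd' t).differentiableAt) fun t => ?_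
      rw [(hd' t).deriv, mul_one]
      exact sub_nonpos.2 (hle t)
    obtain ⟨m, hm⟩ := (isCompact_range f.contMDiff.continuous).bddBelow
    have hm' : ∀ x, m ≤ f x := fun x => hm (mem_range_self x)
    have hδ : 0 < 1 / 2 * supNorm g α ^ 2 - b := by linarith
    -- At this time the linear decay has pushed `f` below its lower bound `m`.
    obtain ⟨N, hN⟩ := exists_nat_gt ((f (γ 0) - m) / (1 / 2 * supNorm g α ^ 2 - b))
    rw [div_lt_iff₀ hδ] at hN
    have h1 := hanti (Nat.cast_nonneg N)
    have h2 := hm' (γ N)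
    simp only [mul_zero, sub_zero] at h1
    nlinarith

/-! ### The description by loops -/

omit [T2Space M] [Nonempty M] in
-- The integrand is nonnegative pointwise, so neither regularity nor closedness of the curve is
-- needed.
theorem integral_magneticLagrangian_nonneg {g : Metric n M}
    {α : (q : M) → TangentSpace (𝓡 n) q →L[ℝ] ℝ}
    (hX : ContMDiff (𝓡 n) (𝓡 n).tangent ∞ (toTangent (dualField g α))) {T : ℝ} (hT : 0 < T)
    (γ : ℝ → M) :
    0 ≤ ∫ t in (0 : ℝ)..T, (magneticLagrangian g α (lift γ t) + 1 / 2 * supNorm g α ^ 2) := by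
  refine intervalIntegral.integral_nonneg hT.le fun t _ => ?_
  have := neg_le_magneticLagrangian hX (lift γ t)
  linarith

omit [CompactSpace M] [T2Space M] [Nonempty M] in
/-- Near every point, coordinate segments have bounded Lagrangian. -/
theorem exists_segment_bound {L : TangentBundle (𝓡 n) M → ℝ} (hL : Continuous L) (x : M) {B : ℝ}
    (hB : L ⟨x, 0⟩ < B) :
    ∃ r > 0, ∀ y ∈ Metric.ball (extChartAt (𝓡 n) x x) r, ∀ w ∈ Metric.ball (0 : Model n) r,
      y ∈ (extChartAt (𝓡 n) x).target ∧ L (ofCoord x y w) < B := by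
  have hT : (extChartAt (𝓡 n) x).target ×ˢ (univ : Set (Model n))
      ∈ 𝓝 (extChartAt (𝓡 n) x x, (0 : Model n)) :=
    prod_mem_nhds (extChartAt_target_mem_nhds x) Filter.univ_mem
  have hc : ContinuousAt (fun p : Model n × Model n => L (ofCoord x p.1 p.2))
      (extChartAt (𝓡 n) x x, 0) :=
    hL.continuousAt.comp ((contMDiffOn_ofCoord x).continuousOn.continuousAt hT)
  have h0 : ofCoord x (extChartAt (𝓡 n) x x) 0 = (⟨x, 0⟩ : TangentBundle (𝓡 n) M) := by
    have h1 : ofCoord x (extChartAt (𝓡 n) x x) 0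
        = (⟨(extChartAt (𝓡 n) x).symm (extChartAt (𝓡 n) x x), 0⟩ : TangentBundle (𝓡 n) M) := by
      unfold ofCoord
      congr 1
      exact map_zero _
    rw [h1, extChartAt_to_inv]
  have hN := Filter.inter_mem hT (hc.preimage_mem_nhds (Iio_mem_nhds (by rwa [h0])))
  obtain ⟨r, hr, hsub⟩ := Metric.mem_nhds_iff.1 hN
  refine ⟨r, hr, fun y hy w hw => ?_⟩
  have : (y, w) ∈ Metric.ball (extChartAt (𝓡 n) x x, (0 : Model n)) r := by
    rw [← ball_prod_same]
    exact mk_mem_prod hy hw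
  exact ⟨(hsub this).1.1, (hsub this).2⟩

omit [IsManifold (𝓡 n) ∞ M] [CompactSpace M] [T2Space M] [Nonempty M] in
theorem lift_congr {γ σ : ℝ → M} {t : ℝ} (h : γ =ᶠ[𝓝 t] σ) :
    (lift γ t : TangentBundle (𝓡 n) M) = lift σ t := by
  simp only [lift]
  rw [h.mfderiv_eq]
  congr 1
  exact h.eq_of_nhds

omit [CompactSpace M] [T2Space M] [Nonempty M] in
/-- Concatenation of a smooth curve with a coordinate segment that closes it up. -/
theorem exists_loop {L : TangentBundle (𝓡 n) M → ℝ} (hL : Continuous L) {γ : ℝ → M}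
    (hγ : ContMDiff 𝓘(ℝ, ℝ) (𝓡 n) ∞ γ) {T : ℝ} (hT : 0 < T) {x : M} {B r : ℝ}
    (hr : ∀ y ∈ Metric.ball (extChartAt (𝓡 n) x x) r, ∀ w ∈ Metric.ball (0 : Model n) r,
      y ∈ (extChartAt (𝓡 n) x).target ∧ L (ofCoord x y w) < B)
    (h0s : γ 0 ∈ (extChartAt (𝓡 n) x).source) (hTs : γ T ∈ (extChartAt (𝓡 n) x).source)
    (h0 : extChartAt (𝓡 n) x (γ 0) ∈ Metric.ball (extChartAt (𝓡 n) x x) (r / 2))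
    (h1 : extChartAt (𝓡 n) x (γ T) ∈ Metric.ball (extChartAt (𝓡 n) x x) (r / 2)) (k : ℝ) :
    ∃ σ : ℝ → M, IsPiecewiseC1 (n := n) (T + 1) σ ∧ σ 0 = σ (T + 1) ∧
      ∫ t in (0 : ℝ)..(T + 1), (L (lift σ t) + k)
        ≤ (∫ t in (0 : ℝ)..T, (L (lift γ t) + k)) + (B + k) := by
  set φ := extChartAt (𝓡 n) x with hφ
  set a := φ (γ T) with ha
  set w := φ (γ 0) - a with hw
  have hr0 : 0 < r := by
    have := dist_nonneg.trans_lt (Metric.mem_ball.1 h0)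
    linarith
  have hwr : w ∈ Metric.ball (0 : Model n) r := by
    rw [mem_ball_zero_iff, hw, ← dist_eq_norm]
    have h2 := dist_triangle_right (φ (γ 0)) a (φ x)
    have h3 := Metric.mem_ball.1 h0
    have h4 := Metric.mem_ball.1 h1
    linarith
  -- The segment from `φ (γ T)` back to `φ (γ 0)`, run in unit time with constant velocity `w`. Both
  -- ends lie in the ball of radius `r / 2`, whence `‖w‖ < r`.
  let y : ℝ → Model n := fun t => a + (t - T) • w
  have hya : ∀ t ∈ Icc T (T + 1), y t ∈ Metric.ball (φ x) r := by
    intro t ht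
    refine Metric.ball_subset_ball (by linarith : r / 2 ≤ r) ?_
    have := (convex_ball (φ x) (r / 2)).add_smul_sub_mem h1 h0
      (t := t - T) ⟨by linarith [ht.1], by linarith [ht.2]⟩
    exact this
  have hyT : ∀ t ∈ Icc T (T + 1), y t ∈ φ.target := fun t ht => (hr _ (hya t ht) w hwr).1
  have hyd : ∀ t, HasDerivAt y w t := by
    intro t
    have h := (((hasDerivAt_id t).sub_const T).smul_const w).const_add a
    rw [one_smul] at h
    exact h
  have hys : ContDiff ℝ ∞ y :=
    contDiff_const.add ((contDiff_id.sub contDiff_const).smul contDiff_const)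
  let σ : ℝ → M := fun t => if t ≤ T then γ t else φ.symm (y t)
  have hσ1 : ∀ t ≤ T, σ t = γ t := fun t ht => if_pos ht
  have hσ2 : ∀ t, T ≤ t → σ t = φ.symm (y t) := by
    intro t ht
    rcases ht.eq_or_lt with rfl | h
    · rw [hσ1 _ le_rfl]
      simp only [y, sub_self, zero_smul, add_zero, ha]
      exact (φ.left_inv hTs).symm
    · exact if_neg (not_le.2 h)
  have hsm1 : ContMDiffOn 𝓘(ℝ, ℝ) (𝓡 n) 1 σ (Iic T) :=
    (hγ.of_le (by simp)).contMDiffOn.congr hσ1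
  have hsm2 : ContMDiffOn 𝓘(ℝ, ℝ) (𝓡 n) 1 σ (Icc T (T + 1)) := by
    have h := (contMDiffOn_extChartAt_symm (I := 𝓡 n) (n := ∞) x).comp
      (hys.contMDiff.contMDiffOn (s := Icc T (T + 1))) hyT
    exact (h.of_le (by simp)).congr fun t ht => hσ2 t ht.1
  have hl1 : ∀ t < T, (lift σ t : TangentBundle (𝓡 n) M) = lift γ t := by
    intro t ht
    refine lift_congr ?_
    filter_upwards [Iio_mem_nhds ht] with s hs using hσ1 s (le_of_lt hs)
  have hl2 : ∀ t ∈ Ioo T (T + 1), (lift σ t : TangentBundle (𝓡 n) M) = ofCoord x (y t) w := by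
    intro t ht
    have h : σ =ᶠ[𝓝 t] fun s => φ.symm (y s) := by
      filter_upwards [Ioi_mem_nhds ht.1] with s hs using hσ2 s (le_of_lt hs)
    rw [lift_congr h]
    exact lift_eq_of_hasMFDerivAt (hasMFDerivAt_ofCoord (hyd t) (hyT t (Ioo_subset_Icc_self ht)))
  refine ⟨σ, ⟨?_, {T}, ?_⟩, ?_, ?_⟩
  · have h := (hsm1.continuousOn.mono (Icc_subset_Iic_self (a := 0))).union_of_isClosed
      hsm2.continuousOn isClosed_Icc isClosed_Icc
    rwa [Icc_union_Icc_eq_Icc hT.le (by linarith)] at h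
  · intro c d hc hcd hd hcut
    have hTcd := hcut T (Finset.mem_singleton_self T)
    rcases le_or_gt d T with h | h
    · exact hsm1.mono fun t ht => ht.2.trans h
    · have : T ≤ c := by
        by_contra hcT
        exact hTcd ⟨not_le.1 hcT, h⟩
      exact hsm2.mono (Icc_subset_Icc this hd)
  · rw [hσ1 0 hT.le, hσ2 (T + 1) (by linarith)]
    simp only [y, add_sub_cancel_left, one_smul, hw, add_sub_cancel]
    exact (φ.left_inv h0s).symm
  · have hci1 : IntervalIntegrable (fun t => L (lift γ t) + k) volume 0 T :=
      ((hL.comp (continuous_lift (hγ.of_le two_le_infty))).add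
        continuous_const).intervalIntegrable _ _
    have hcon : ContinuousOn (fun t => L (ofCoord x (y t) w) + k) (Icc T (T + 1)) := by
      refine ContinuousOn.add (hL.comp_continuousOn ?_) continuousOn_const
      exact (contMDiffOn_ofCoord x).continuousOn.comp
        (hys.continuous.prodMk continuous_const).continuousOn fun t ht => ⟨hyT t ht, mem_univ _⟩
    have hci2 : IntervalIntegrable (fun t => L (ofCoord x (y t) w) + k) volume T (T + 1) :=
      ContinuousOn.intervalIntegrable (by rwa [uIcc_of_le (by linarith)])
    -- The lifts are compared on open intervals only: at the corner `T` the velocity of `σ` is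
    -- uncontrolled, and a point has measure zero.
    have he1 : EqOn (fun t => L (lift γ t) + k) (fun t => L (lift σ t) + k) (uIoo 0 T) := by
      intro t ht
      rw [uIoo_of_le hT.le] at ht
      simp only [hl1 t ht.2]
    have he2 : EqOn (fun t => L (ofCoord x (y t) w) + k) (fun t => L (lift σ t) + k)
        (uIoo T (T + 1)) := by
      intro t ht
      rw [uIoo_of_le (by linarith)] at ht
      simp only [hl2 t ht]
    rw [← intervalIntegral.integral_add_adjacent_intervals (hci1.congr_uIoo he1)
      (hci2.congr_uIoo he2), ← intervalIntegral.integral_congr_uIoo he1,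
      ← intervalIntegral.integral_congr_uIoo he2]
    refine add_le_add le_rfl ?_
    have := intervalIntegral.integral_mono_on (by linarith : T ≤ T + 1) hci2
      (intervalIntegrable_const (c := B + k))
      fun t ht => by
        have := (hr _ (hya t ht) w hwr).2
        linarith
    simpa using this

theorem maneValueLoops_eq {g : Metric n M} {α : (q : M) → TangentSpace (𝓡 n) q →L[ℝ] ℝ}
    (hK : IsKilling g (dualField g α)) :
    maneValueLoops (magneticLagrangian g α) = ((1 / 2 * supNorm g α ^ 2 : ℝ) : EReal) := by
  have hX := hK.smooth
  have hL := (contMDiff_magneticLagrangian g α hX).continuous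
  apply le_antisymm
  · exact sInf_le ⟨_, fun T hT γ _ _ => integral_magneticLagrangian_nonneg hX hT γ, rfl⟩
  · refine le_sInf ?_
    rintro _ ⟨k, hk, rfl⟩
    rw [EReal.coe_le_coe_iff]
    by_contra hlt
    rw [not_le] at hlt
    obtain ⟨q, hq⟩ := maxSet_nonempty hX
    have hγ := isMIntegralCurve_flow hX q
    -- Only approximate recurrence is available: the orbit at integer times returns arbitrarily late
    -- to any neighborhood of `x`.
    obtain ⟨x, -, hx⟩ := isCompact_univ.exists_mapClusterPt (f := Filter.atTop)
      (u := fun N : ℕ => flow (dualField g α) N q) (by simp)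
    -- `L` vanishes on zero vectors, so any positive bound would do; `1` makes the closing segment
    -- cost at most `1 + k`.
    have hLx : magneticLagrangian g α ⟨x, 0⟩ < 1 := by
      simp [magneticLagrangian]
    obtain ⟨r, hr0, hr⟩ := exists_segment_bound hL x hLx
    have hU : (extChartAt (𝓡 n) x).source ∩ extChartAt (𝓡 n) x ⁻¹'
        Metric.ball (extChartAt (𝓡 n) x x) (r / 2) ∈ 𝓝 x :=
      Filter.inter_mem (extChartAt_source_mem_nhds x)
        ((continuousAt_extChartAt x).preimage_mem_nhds (Metric.ball_mem_nhds _ (half_pos hr0)))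
    have hfreq := (mapClusterPt_iff_frequently.1 hx) _ hU
    rw [Filter.frequently_atTop] at hfreq
    obtain ⟨N₁, -, hN₁⟩ := hfreq 0
    -- With `c = ½‖α‖_∞²`, a travel time `T ≥ R + 1` gives `T (c - k) > 1 + k`: the gain along the
    -- orbit exceeds the closing cost.
    obtain ⟨R, hR⟩ := exists_nat_gt ((1 + k) / (1 / 2 * supNorm g α ^ 2 - k))
    obtain ⟨N₂, hN₂, hN₂'⟩ := hfreq (N₁ + R + 1)
    have hcast : (N₁ : ℝ) + R + 1 ≤ N₂ := by exact_mod_cast hN₂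
    have hδ : 0 < 1 / 2 * supNorm g α ^ 2 - k := by linarith
    rw [div_lt_iff₀ hδ] at hR
    set T : ℝ := N₂ - N₁ with hTdef
    have hT : (R : ℝ) + 1 ≤ T := by linarith
    have hT0 : 0 < T := lt_of_lt_of_le (by positivity) hT
    have hc := (isMIntegralCurve_flow hX q).comp_add (N₁ : ℝ)
    set c : ℝ → M := (fun t => flow (dualField g α) t q) ∘ fun t => t + (N₁ : ℝ) with hcdef
    have hc0 : c 0 = flow (dualField g α) N₁ q := by simp [hcdef]
    have hcT : c T = flow (dualField g α) N₂ q := by simp [hcdef, hTdef]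
    obtain ⟨σ, hσ1, hσ2, hσ3⟩ := exists_loop hL (contMDiff_integralCurve hX hc) hT0 hr
      (hc0 ▸ hN₁.1) (hcT ▸ hN₂'.1) (hc0 ▸ hN₁.2) (hcT ▸ hN₂'.2) k
    have hpos := hk (T + 1) (by linarith) σ hσ1 hσ2
    have hval : ∀ t, magneticLagrangian g α (lift c t) + k = k - 1 / 2 * supNorm g α ^ 2 := by
      intro t
      rw [(magneticLagrangian_eq_neg_iff hX _).2]
      · ring
      · rw [IsMIntegralCurve.lift_eq hc]
        exact mem_image_of_mem _ (flow_mem_maxSet hK hq _)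
    simp only [hval, intervalIntegral.integral_const, sub_zero, smul_eq_mul] at hσ3
    nlinarith

end Mane

end

end MagneticMane

end

/-- A measure on `M_α` is encoded as a measure on `M` for which the complement of `M_α` is null; as
`M_α` is closed, this does not change its support. -/
theorem theorem2p4 {n : ℕ} {M : Type*} [TopologicalSpace M]
    [ChartedSpace (MagneticMane.Model n) M] [IsManifold (𝓡 n) ∞ M]
    [CompactSpace M] [T2Space M] [Nonempty M]
    [MeasurableSpace M] [BorelSpace M]
    [MeasurableSpace (TangentBundle (𝓡 n) M)] [BorelSpace (TangentBundle (𝓡 n) M)]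
    (g : MagneticMane.Metric n M) (α : (q : M) → TangentSpace (𝓡 n) q →L[ℝ] ℝ)
    (hα : ContMDiff (𝓡 n) ((𝓡 n).prod 𝓘(ℝ, MagneticMane.Model n →L[ℝ] ℝ)) ∞
      (fun q : M => TotalSpace.mk' (MagneticMane.Model n →L[ℝ] ℝ)
        (E := fun q : M => TangentSpace (𝓡 n) q →L[ℝ] ℝ) q (α q)))
    (hK : MagneticMane.IsKilling g (MagneticMane.dualField g α)) :
    -- the Mañé critical value, in each of its three descriptions
    (MagneticMane.maneValueHamiltonian (MagneticMane.magneticHamiltonian g α)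
        = ((1 / 2 * MagneticMane.supNorm g α ^ 2 : ℝ) : EReal) ∧
      MagneticMane.maneValueLoops (MagneticMane.magneticLagrangian g α)
        = ((1 / 2 * MagneticMane.supNorm g α ^ 2 : ℝ) : EReal) ∧
      MagneticMane.maneValueMeasures (MagneticMane.magneticLagrangian g α)
        = ((1 / 2 * MagneticMane.supNorm g α ^ 2 : ℝ) : EReal)) ∧
    -- the flow of `X` restricts to `M_α`
    (∀ t : ℝ, MagneticMane.flow (MagneticMane.dualField g α) t '' MagneticMane.maxSet g α
      = MagneticMane.maxSet g α) ∧
    -- the projected Mather set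
    MagneticMane.projectedMatherSet (MagneticMane.magneticLagrangian g α)
      = ⋃ (ν : Measure M) (_ : MagneticMane.IsInvariantProb
            (MagneticMane.flow (MagneticMane.dualField g α)) ν)
          (_ : ν (MagneticMane.maxSet g α)ᶜ = 0), ν.support ∧
    -- it contains the periodic orbits of `X` in `M_α`
    (∀ γ : ℝ → M, IsMIntegralCurve (I := 𝓡 n) γ (MagneticMane.dualField g α) →
      γ 0 ∈ MagneticMane.maxSet g α → (∃ T : ℝ, 0 < T ∧ Function.Periodic γ T) →
      range γ ⊆ MagneticMane.projectedMatherSet (MagneticMane.magneticLagrangian g α)) ∧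
    -- the Mather set
    MagneticMane.matherSet (MagneticMane.magneticLagrangian g α)
      = MagneticMane.toTangent (MagneticMane.dualField g α) ''
          MagneticMane.projectedMatherSet (MagneticMane.magneticLagrangian g α) := by
  exact ⟨⟨MagneticMane.maneValueHamiltonian_eq hK, MagneticMane.maneValueLoops_eq hK,
      MagneticMane.maneValueMeasures_eq hK⟩,
    MagneticMane.flow_image_maxSet hK, MagneticMane.projectedMatherSet_eq hK,
    fun γ hγ h0 ⟨T, hT, hper⟩ => MagneticMane.periodic_subset_projectedMatherSet hK hγ h0 hT hper,
    by rw [MagneticMane.projectedMatherSet_eq hK, MagneticMane.matherSet_eq hK]⟩
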